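/- Let $d\in\mathbb N$, $d\ge 1$, and $\rho>0$ with $d\neq 2\rho$. Let $(k,\ell)$ be of type $(\mathcal{PC})$: $k\in L_{1,loc}([0,\infty))$ is nonnegative and nonincreasing, $\ell\in L_{1,loc}([0,\infty))$, and $(k*\ell)(t)=\int_0^t k(t-s)\ell(s)\,ds=1$ in $(0,\infty)$ (as an identity in $L_{1,loc}$). Let $u_0\in L_1(\mathbb R^d)\cap L_2(\mathbb R^d)$. For $\tau\ge 0$ let $w(\cdot,\tau)$ be the propagation function, i.e. the unique nondecreasing, left-continuous function of bounded variation on $[0,\infty)$ with $w(0,\tau)=0$ and $$\int_0^\infty e^{-\lambda\sigma}w(\sigma,\tau)\,d\sigma=\frac1\lambda\exp\bigl(-\tau\lambda\widehat k(\lambda)\bigr),\quad \lambda>0,\qquad \widehat k(\lambda)=\int_0^\infty e^{-\lambda\sigma}k(\sigma)\,d\sigma ;$$ for $t>0$ the function $w(t,\cdot)$ is nonincreasing and right-continuous. For $\tau>0$ let $\eta^\rho_\tau(x)=(2\pi)^{-d}\int_{\mathbb R^d}e^{ix\cdot\xi}e^{-\tau|\xi|^\rho}\,d\xi$ be the kernel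 of the semigroup generated by $-(-\Delta)^{\rho/2}$, and for $t>0$ put $$Z(t,x)=-\int_0^\infty \eta^\rho_\tau(x)\,w(t,d\tau),\qquad u(t,x)=\int_{\mathbb R^d}Z(t,x-y)u_0(y)\,dy ,$$ so that $u$ is the mild solution of $\partial_t(k*[u-u_0])+(-\Delta)^{\rho/2}u=0$, $u(0,\cdot)=u_0$. Then for every $t>0$ these integrals converge absolutely for almost every $x$ and $u(t,\cdot)\in L_2(\mathbb R^d)$, and there is a constant $C>0$ such that, with $(1*\ell)(t)=\int_0^t\ell(s)\,ds$, $$\|u(t,\cdot)\|_{L_2(\mathbb R^d)}\le C\,\bigl[(1*\ell)(t)\bigr]^{-\min\{1,\,d/(2\rho)\}}\quad\text{for all } t>1 .$$ -/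

import Mathlib

noncomputable section

namespace NonlocalDiffusion

open MeasureTheory Set

/-- Convolution on the half-line: `(f * g)(t) = ∫₀ᵗ f(t - s) g(s) ds`. -/
def timeConv (f g : ℝ → ℝ) (t : ℝ) : ℝ :=
  ∫ s in (0 : ℝ)..t, f (t - s) * g s

/-- The pair `(k, ℓ)` is of type `(PC)`: `k ∈ L_{1,loc}([0,∞))` is nonnegative and nonincreasing,
`ℓ ∈ L_{1,loc}([0,∞))`, and `k * ℓ = 1` on `(0,∞)`, as an identity in `L_{1,loc}`, that is,
almost everywhere. -/
structure IsPC (k ℓ : ℝ → ℝ) : Prop where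
  locallyIntegrable_k : ∀ T : ℝ, 0 < T → IntegrableOn k (Ioc 0 T)
  nonneg_k : ∀ t : ℝ, 0 < t → 0 ≤ k t
  antitone_k : AntitoneOn k (Ioi 0)
  locallyIntegrable_l : ∀ T : ℝ, 0 < T → IntegrableOn ℓ (Ioc 0 T)
  conv_eq_one : ∀ᵐ t : ℝ ∂(volume.restrict (Ioi 0)), timeConv k ℓ t = 1

/-- The Laplace transform `∫₀^∞ e^{-pσ} f(σ) dσ`. -/
def laplace (f : ℝ → ℝ) (p : ℝ) : ℝ :=
  ∫ σ in Ioi (0 : ℝ), Real.exp (-(p * σ)) * f σ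

/-- `v = w(·, τ)` is the propagation function with parameter `τ`: it is nondecreasing and of
bounded variation on `[0,∞)`, left-continuous, normalized by `v(0) = 0`, and its Laplace transform
is `ψ_τ(p) / p` with `ψ_τ(p) = exp(-τ φ(p))` and `φ(p) = p k̂(p)`. These properties determine `v`
on `[0,∞)`. -/
structure IsPropagation (k : ℝ → ℝ) (τ : ℝ) (v : ℝ → ℝ) : Prop where
  mono : MonotoneOn v (Ici 0)
  bv : BoundedVariationOn v (Ici 0)
  zero : v 0 = 0
  leftCont : ∀ σ : ℝ, 0 < σ → ContinuousWithinAt v (Iic σ) σ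
  laplace_eq : ∀ p : ℝ, 0 < p → laplace v p = Real.exp (-(τ * (p * laplace k p))) / p

open Classical in
/-- The propagation function `w(t, τ)` of `k`. It exists (Bernstein's theorem) and is unique on
`[0,∞) × [0,∞)` for every `k` with `(k, ℓ)` of type `(PC)`; for other `k` the value is junk. -/
def propagation (k : ℝ → ℝ) : ℝ → ℝ → ℝ :=
  if h : ∃ w : ℝ → ℝ → ℝ, ∀ τ : ℝ, 0 ≤ τ → IsPropagation k τ (fun σ => w σ τ)
  then h.choose else 0

open Classical in
/-- The Lebesgue–Stieltjes measure `-w(t, dτ)` on `[0,∞)`. For `t > 0` the function `w(t, ·)` is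
nonincreasing and right-continuous on `[0,∞)`; it is extended constantly to the left of `0`, so
that no mass is created there. -/
def propagationMeasure (k : ℝ → ℝ) (t : ℝ) : Measure ℝ :=
  if h : Monotone (fun τ : ℝ => -propagation k t (max τ 0))
  then h.stieltjesFunction.measure else 0

/-- The density `η^ρ_τ`, `τ > 0`, of the convolution semigroup with symbol `|ξ|^ρ`, that is, the
function with `∫ e^{-i x·ξ} η^ρ_τ(x) dx = e^{-τ|ξ|^ρ}`:
`η^ρ_τ(x) = (2π)^{-d} ∫ e^{i x·ξ} e^{-τ|ξ|^ρ} dξ`. -/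
def eta (d : ℕ) (ρ τ : ℝ) (x : EuclideanSpace ℝ (Fin d)) : ℂ :=
  (((2 * Real.pi) ^ d : ℝ) : ℂ)⁻¹ *
    ∫ ξ : EuclideanSpace ℝ (Fin d),
      Complex.exp (Complex.I * ((inner ℝ x ξ : ℝ) : ℂ)) * ((Real.exp (-(τ * ‖ξ‖ ^ ρ)) : ℝ) : ℂ)

/-- The fundamental solution `Z(t, x) = -∫₀^∞ η^ρ_τ(x) w(t, dτ)`. -/
def fundamentalSolution (d : ℕ) (ρ : ℝ) (k : ℝ → ℝ) (t : ℝ) (x : EuclideanSpace ℝ (Fin d)) : ℂ :=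
  ∫ τ in Ioi (0 : ℝ), eta d ρ τ x ∂(propagationMeasure k t)

/-- The mild solution with `f = 0`: `u(t, x) = ∫ Z(t, x - y) u₀(y) dy`. -/
def mildSolution (d : ℕ) (ρ : ℝ) (k : ℝ → ℝ) (u₀ : EuclideanSpace ℝ (Fin d) → ℂ) (t : ℝ)
    (x : EuclideanSpace ℝ (Fin d)) : ℂ :=
  ∫ y : EuclideanSpace ℝ (Fin d), fundamentalSolution d ρ k t (x - y) * u₀ y

end NonlocalDiffusion

end

/-!
By Plancherel's theorem it suffices to bound the Fourier transform of the solution, which at the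
frequency `ζ` is `û₀(ζ) ∫ e^{-qτ} (-w(t, dτ))` with `q = (2π‖ζ‖)^ρ`.

The function `w(·, τ)` is the distribution function of the law `μ_τ` at time `τ` of a killed
subordinator with Laplace exponent `p k̂(p)`. Subordinators do not jump back, hence
`w(t, a + b) ≤ w(t, a) w(t, b)`. The potential measure `U = ∫ μ_τ dτ` satisfies `k * U = 1`, so
`k * ℓ = 1` forces `U` to have density `ℓ`, that is, `∫ w(t, τ) dτ = U[0, t) = (1 * ℓ)(t)`.
These two facts give the relaxation estimate `∫ e^{-qτ} (-w(t, dτ)) ≤ 1 / (1 + q (1 * ℓ)(t))`.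

It remains to estimate the `L₂` norm of `û₀(ζ) / (1 + q (1 * ℓ)(t))`, where `û₀` is bounded and
square integrable. If `2ρ < d`, then `‖ζ‖^{-2ρ}` is integrable near the origin and the factor
`1 / (1 + q (1 * ℓ)(t)) ≤ 1 / (q (1 * ℓ)(t))` yields the decay `(1 * ℓ)(t)⁻¹`. If `d < 2ρ`, then
`1 / (1 + (2π‖ζ‖)^ρ)` is square integrable and rescaling `ζ` yields `(1 * ℓ)(t)^{-d/(2ρ)}`.
-/

noncomputable section

namespace NonlocalDiffusion

open MeasureTheory Set Filter Topology
open scoped ENNReal NNReal FourierTransform SchwartzMap Convolution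

/-! ### Lebesgue measure and convolution on the half-line -/

/-- Lebesgue measure on the half-line `[0,∞)`. -/
def lebesgue : Measure ℝ≥0 := Measure.comap ((↑) : ℝ≥0 → ℝ) volume

lemma measurableEmbedding_coe_nnreal : MeasurableEmbedding ((↑) : ℝ≥0 → ℝ) :=
  MeasurableEmbedding.subtype_coe measurableSet_Ici

lemma map_coe_lebesgue : lebesgue.map ((↑) : ℝ≥0 → ℝ) = volume.restrict (Ioi 0) := by
  rw [lebesgue, measurableEmbedding_coe_nnreal.map_comap, NNReal.range_coe,
    Measure.restrict_congr_set Ioi_ae_eq_Ici]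

instance : SigmaFinite lebesgue :=
  .of_map _ measurable_coe_nnreal_real.aemeasurable (map_coe_lebesgue ▸ inferInstance)

lemma lintegral_coe_lebesgue (f : ℝ → ℝ≥0∞) :
    ∫⁻ t : ℝ≥0, f t ∂lebesgue = ∫⁻ t in Ioi (0 : ℝ), f t := by
  rw [← map_coe_lebesgue, measurableEmbedding_coe_nnreal.lintegral_map]

lemma setLIntegral_Iio_lebesgue (f : ℝ → ℝ≥0∞) (t : ℝ≥0) :
    ∫⁻ s in Iio t, f s ∂lebesgue = ∫⁻ s in Ioo (0 : ℝ) t, f s := by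
  have key : ∀ s : ℝ≥0, (Iio t).indicator (fun s : ℝ≥0 => f s) s =
      (Iio (t : ℝ)).indicator f s := fun s => by simp [indicator]
  rw [← lintegral_indicator measurableSet_Iio, lintegral_congr key, lintegral_coe_lebesgue,
    setLIntegral_indicator measurableSet_Iio, inter_comm, Ioi_inter_Iio]

lemma lebesgue_Iio (t : ℝ≥0) : lebesgue (Iio t) = t := by
  simpa using setLIntegral_Iio_lebesgue 1 t

instance : NullSingletonClass lebesgue where
  measure_singleton t := by
    rw [lebesgue, measurableEmbedding_coe_nnreal.comap_apply]
    simp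

instance : lebesgue.IsOpenPosMeasure where
  open_pos U hU hne := by
    obtain ⟨a, b, hab, hsub⟩ := hU.exists_Ioo_subset hne
    refine fun h0 => hab.not_ge ?_
    have hle : lebesgue (Iio b) ≤ lebesgue (Iic a) + lebesgue (Ioo a b) :=
      (measure_mono fun x hx => (le_or_gt x a).imp id fun h => ⟨h, hx⟩).trans (measure_union_le _ _)
    rw [measure_mono_null hsub h0, add_zero, ← measure_congr Iio_ae_eq_Iic] at hle
    simpa [lebesgue_Iio] using hle

lemma lintegral_lebesgue_add_right (f : ℝ≥0 → ℝ≥0∞) (s : ℝ≥0) :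
    ∫⁻ x, f (x + s) ∂lebesgue = ∫⁻ t in Ioi s, f t ∂lebesgue := by
  have key : ∀ t : ℝ≥0, (Ioi s).indicator f t =
      (Ioi (s : ℝ)).indicator (fun r => f r.toNNReal) t := fun t => by simp [indicator]
  have hpre : (fun r : ℝ => r + s) ⁻¹' Ioi (s : ℝ) = Ioi 0 := by ext; simp
  have hmp := (measurePreserving_add_right volume (s : ℝ)).restrict_preimage
    (measurableSet_Ioi (a := (s : ℝ)))
  rw [hpre] at hmp
  calc ∫⁻ x, f (x + s) ∂lebesgue = ∫⁻ r in Ioi (0 : ℝ), f (r + s).toNNReal := by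
        rw [← lintegral_coe_lebesgue fun r => f (r + s).toNNReal]
        exact lintegral_congr fun x => by rw [← NNReal.coe_add, Real.toNNReal_coe]
    _ = ∫⁻ r in Ioi (s : ℝ), f r.toNNReal :=
        hmp.lintegral_comp_emb (measurableEmbedding_addRight _) fun r => f r.toNNReal
    _ = ∫⁻ t in Ioi s, f t ∂lebesgue := by
        rw [← lintegral_indicator measurableSet_Ioi f, lintegral_congr key, lintegral_coe_lebesgue,
          setLIntegral_indicator measurableSet_Ioi,
          inter_eq_self_of_subset_left (Ioi_subset_Ioi s.coe_nonneg)]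

lemma measurable_lintegral_Iio_sub {f : ℝ≥0 → ℝ≥0∞} (hf : Measurable f) (ν : Measure ℝ≥0)
    [SFinite ν] : Measurable fun t => ∫⁻ s in Iio t, f (t - s) ∂ν := by
  simp_rw [← lintegral_indicator measurableSet_Iio]
  refine Measurable.lintegral_prod_right' (f := fun p : ℝ≥0 × ℝ≥0 =>
    (Iio p.1).indicator (fun s => f (p.1 - s)) p.2) ?_
  exact (hf.comp (measurable_fst.sub measurable_snd)).indicator
    (measurableSet_lt measurable_snd measurable_fst)

lemma lebesgue_withDensity_conv {f : ℝ≥0 → ℝ≥0∞} (hf : Measurable f) (ν : Measure ℝ≥0) [SFinite ν] :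
    (lebesgue.withDensity f).conv ν =
      lebesgue.withDensity fun t => ∫⁻ s in Iio t, f (t - s) ∂ν := by
  refine Measure.ext_of_lintegral _ fun g hg => ?_
  have hswap : Measurable fun p : ℝ≥0 × ℝ≥0 => f p.1 * g (p.1 + p.2) := by fun_prop
  have hind : Measurable fun p : ℝ≥0 × ℝ≥0 =>
      (Ioi p.1).indicator (fun t => f (t - p.1) * g t) p.2 :=
    ((hf.comp (measurable_snd.sub measurable_fst)).mul (hg.comp measurable_snd)).indicator
      (measurableSet_lt measurable_fst measurable_snd)
  calc ∫⁻ z, g z ∂(lebesgue.withDensity f).conv ν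
      = ∫⁻ x, f x * ∫⁻ s, g (x + s) ∂ν ∂lebesgue := by
        rw [Measure.lintegral_conv hg]
        exact lintegral_withDensity_eq_lintegral_mul _ hf (by fun_prop)
    _ = ∫⁻ s, ∫⁻ x, f x * g (x + s) ∂lebesgue ∂ν := by
        rw [← lintegral_lintegral_swap hswap.aemeasurable]
        exact lintegral_congr fun x => (lintegral_const_mul _ (by fun_prop)).symm
    _ = ∫⁻ s, ∫⁻ t, (Ioi s).indicator (fun t => f (t - s) * g t) t ∂lebesgue ∂ν :=
        lintegral_congr fun s => by
          rw [lintegral_indicator measurableSet_Ioi, ← lintegral_lebesgue_add_right]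
          simp only [add_tsub_cancel_right]
    _ = ∫⁻ t, ∫⁻ s, (Iio t).indicator (fun s => f (t - s)) s * g t ∂ν ∂lebesgue := by
        rw [lintegral_lintegral_swap hind.aemeasurable]
        refine lintegral_congr fun t => lintegral_congr fun s => ?_
        by_cases h : s < t <;> simp [h]
    _ = ∫⁻ t, (∫⁻ s in Iio t, f (t - s) ∂ν) * g t ∂lebesgue :=
        lintegral_congr fun t => by
          have hm : Measurable fun s => f (t - s) := hf.comp (measurable_const.sub measurable_id)
          rw [lintegral_mul_const _ (hm.indicator measurableSet_Iio),
            lintegral_indicator measurableSet_Iio]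
    _ = ∫⁻ t, g t ∂lebesgue.withDensity fun t => ∫⁻ s in Iio t, f (t - s) ∂ν :=
        (lintegral_withDensity_eq_lintegral_mul _ (measurable_lintegral_Iio_sub hf ν) hg).symm

lemma lebesgue_conv (ν : Measure ℝ≥0) [SFinite ν] :
    lebesgue.conv ν = lebesgue.withDensity fun t => ν (Iio t) := by
  simpa using lebesgue_withDensity_conv (measurable_const (a := (1 : ℝ≥0∞))) ν

lemma monotone_measure_Iio (ν : Measure ℝ≥0) : Monotone fun t => ν (Iio t) := fun _ _ hst =>
  measure_mono (Iio_subset_Iio hst)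

/-! ### Laplace transforms of measures -/

/-- The Laplace transform `∫ e^{-px} ν(dx)` of a measure on the half-line. -/
def measureLaplace (ν : Measure ℝ≥0) (p : ℝ) : ℝ≥0∞ :=
  ∫⁻ x : ℝ≥0, ENNReal.ofReal (Real.exp (-(p * x))) ∂ν

lemma measureLaplace_le_univ (ν : Measure ℝ≥0) {p : ℝ} (hp : 0 ≤ p) :
    measureLaplace ν p ≤ ν univ := by
  refine (lintegral_mono fun x => ?_).trans_eq lintegral_one
  exact ENNReal.ofReal_le_one.2 (Real.exp_le_one_iff.2 (neg_nonpos.2 (by positivity)))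

lemma measureLaplace_dirac_zero (p : ℝ) : measureLaplace (Measure.dirac 0) p = 1 := by
  simp [measureLaplace]

lemma measureLaplace_add (μ ν : Measure ℝ≥0) (p : ℝ) :
    measureLaplace (μ + ν) p = measureLaplace μ p + measureLaplace ν p :=
  lintegral_add_measure _ _ _

lemma measureLaplace_withDensity (μ : Measure ℝ≥0) {f : ℝ≥0 → ℝ≥0∞} (hf : AEMeasurable f μ)
    (p : ℝ) : measureLaplace (μ.withDensity f) p =
      ∫⁻ t, ENNReal.ofReal (Real.exp (-(p * t))) * f t ∂μ := by
  rw [measureLaplace, lintegral_withDensity_eq_lintegral_mul₀ hf (by fun_prop)]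
  exact lintegral_congr fun t => mul_comm _ _

lemma measureLaplace_lebesgue {p : ℝ} (hp : 0 < p) :
    measureLaplace lebesgue p = ENNReal.ofReal p⁻¹ := by
  have hint : Integrable (fun t => Real.exp (-(p * t))) (volume.restrict (Ioi 0)) := by
    simpa [IntegrableOn] using exp_neg_integrableOn_Ioi 0 hp
  rw [measureLaplace, lintegral_coe_lebesgue fun t => ENNReal.ofReal (Real.exp (-(p * t))),
    ← ofReal_integral_eq_lintegral_ofReal hint (ae_of_all _ fun _ => (Real.exp_pos _).le)]
  simpa [neg_mul, one_div] using
    congrArg ENNReal.ofReal (integral_exp_mul_Ioi (neg_neg_of_pos hp) 0)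

lemma ofReal_mul_measureLaplace_lebesgue {p : ℝ} (hp : 0 < p) :
    ENNReal.ofReal p * measureLaplace lebesgue p = 1 := by
  rw [measureLaplace_lebesgue hp, ← ENNReal.ofReal_mul hp.le, mul_inv_cancel₀ hp.ne',
    ENNReal.ofReal_one]

lemma measureLaplace_conv (μ ν : Measure ℝ≥0) [SFinite ν] (p : ℝ) :
    measureLaplace (μ.conv ν) p = measureLaplace μ p * measureLaplace ν p := by
  have hexp : ∀ x y : ℝ≥0, ENNReal.ofReal (Real.exp (-(p * (x + y : ℝ≥0)))) =
      ENNReal.ofReal (Real.exp (-(p * x))) * ENNReal.ofReal (Real.exp (-(p * y))) := fun x y => by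
    rw [← ENNReal.ofReal_mul (Real.exp_pos _).le, ← Real.exp_add]
    push_cast
    ring_nf
  rw [measureLaplace, Measure.lintegral_conv (by fun_prop)]
  simp only [hexp]
  rw [measureLaplace, measureLaplace, ← lintegral_mul_const _ (by fun_prop)]
  exact lintegral_congr fun x => lintegral_const_mul _ (by fun_prop)

/-- Integration by parts, as the Laplace transform of `lebesgue ∗ ν`. -/
lemma measureLaplace_eq_mul_lintegral_Iio (ν : Measure ℝ≥0) [SFinite ν] {p : ℝ} (hp : 0 < p) :
    measureLaplace ν p = ENNReal.ofReal p *
      ∫⁻ t : ℝ≥0, ENNReal.ofReal (Real.exp (-(p * t))) * ν (Iio t) ∂lebesgue := by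
  rw [← measureLaplace_withDensity _ (monotone_measure_Iio ν).measurable.aemeasurable,
    ← lebesgue_conv, measureLaplace_conv, ← mul_assoc, ofReal_mul_measureLaplace_lebesgue hp,
    one_mul]

/-- Stone–Weierstrass: an injective bounded continuous function generates a point-separating
algebra, so its moments determine a finite measure. -/
lemma ext_of_forall_integral_pow_eq {E : Type*} [TopologicalSpace E] [PolishSpace E]
    [MeasurableSpace E] [BorelSpace E] {μ ν : Measure E} [IsFiniteMeasure μ] [IsFiniteMeasure ν]
    {g : BoundedContinuousFunction E ℝ} (hg : Function.Injective g)
    (h : ∀ n : ℕ, ∫ x, g x ^ n ∂μ = ∫ x, g x ^ n ∂ν) : μ = ν := by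
  let A : StarSubalgebra ℝ (BoundedContinuousFunction E ℝ) :=
    { Algebra.adjoin ℝ {g} with
      star_mem' := fun {a} ha => by rwa [show star a = a by ext x; simp] }
  refine ext_of_forall_mem_subalgebra_integral_eq_of_polish (𝕜 := ℝ) (A := A) ?_ ?_
  · exact fun x y hxy => ⟨fun z => g z, ⟨BoundedContinuousFunction.toContinuousMapStarₐ ℝ g,
      ⟨g, Algebra.subset_adjoin rfl, rfl⟩, rfl⟩, hg.ne hxy⟩
  · intro f (hf : f ∈ Algebra.adjoin ℝ {g})
    rw [Algebra.adjoin_singleton_eq_range_aeval] at hf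
    obtain ⟨q, rfl⟩ := hf
    change ∫ x, (Polynomial.aeval g q) x ∂μ = ∫ x, (Polynomial.aeval g q) x ∂ν
    induction q using Polynomial.induction_on' with
    | add q r hq hr =>
      simp only [map_add, BoundedContinuousFunction.coe_add, Pi.add_apply]
      rw [integral_add (BoundedContinuousFunction.integrable _ _)
        (BoundedContinuousFunction.integrable _ _), hq, hr,
        integral_add (BoundedContinuousFunction.integrable _ _)
        (BoundedContinuousFunction.integrable _ _)]
    | monomial n a =>
      simp [Polynomial.aeval_monomial, integral_const_mul, h n]

/-- The injection `x ↦ e^{-x}`, whose moments are the values of the Laplace transform at the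
natural numbers. -/
def expNegBCF : BoundedContinuousFunction ℝ≥0 ℝ :=
  BoundedContinuousFunction.mkOfBound ⟨fun x => Real.exp (-x), by fun_prop⟩ 1 fun x y => by
    have h : ∀ z : ℝ≥0, Real.exp (-z) ∈ Icc (0 : ℝ) 1 := fun z =>
      ⟨(Real.exp_pos _).le, Real.exp_le_one_iff.2 (neg_nonpos.2 z.2)⟩
    exact (Real.dist_le_of_mem_Icc_01 (h x) (h y))

lemma expNegBCF_injective : Function.Injective expNegBCF := fun _ _ h =>
  NNReal.coe_injective (neg_injective (Real.exp_injective h))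

lemma integral_expNegBCF_pow (μ : Measure ℝ≥0) (n : ℕ) :
    ∫ x, expNegBCF x ^ n ∂μ = (measureLaplace μ n).toReal := by
  have hpow : ∀ x : ℝ≥0, expNegBCF x ^ n = Real.exp (-(n * x)) := fun x => by
    rw [show expNegBCF x = Real.exp (-x) from rfl, ← Real.exp_nat_mul, mul_neg]
  simp only [measureLaplace, hpow]
  exact integral_eq_lintegral_of_nonneg_ae (ae_of_all _ fun x => (Real.exp_pos _).le) (by fun_prop)

lemma ext_of_measureLaplace_natCast {μ ν : Measure ℝ≥0} [IsFiniteMeasure μ] [IsFiniteMeasure ν]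
    (h : ∀ n : ℕ, measureLaplace μ n = measureLaplace ν n) : μ = ν :=
  ext_of_forall_integral_pow_eq expNegBCF_injective fun n => by
    rw [integral_expNegBCF_pow, integral_expNegBCF_pow, h]

lemma measureLaplace_withDensity_exp (μ : Measure ℝ≥0) (a p : ℝ) :
    measureLaplace (μ.withDensity fun x => ENNReal.ofReal (Real.exp (-(a * x)))) p =
      measureLaplace μ (p + a) := by
  rw [measureLaplace_withDensity _ (by fun_prop)]
  refine lintegral_congr fun x => ?_
  rw [← ENNReal.ofReal_mul (Real.exp_pos _).le, ← Real.exp_add]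
  ring_nf

/-- The measures `e^{-x} μ(dx)` and `e^{-x} ν(dx)` are finite and have the same moments. -/
theorem ext_of_measureLaplace {μ ν : Measure ℝ≥0} (hfin : ∀ p, 0 < p → measureLaplace μ p ≠ ⊤)
    (h : ∀ p, 0 < p → measureLaplace μ p = measureLaplace ν p) : μ = ν := by
  set e : ℝ≥0 → ℝ≥0∞ := fun x => ENNReal.ofReal (Real.exp (-(1 * x)))
  have hem : Measurable e := by fun_prop
  have hfinite : ∀ m : Measure ℝ≥0, measureLaplace m 1 ≠ ⊤ →
      IsFiniteMeasure (m.withDensity e) := fun m hm => by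
    refine isFiniteMeasure_withDensity ?_
    simpa only [measureLaplace] using hm
  have : IsFiniteMeasure (μ.withDensity e) := hfinite μ (hfin 1 one_pos)
  have : IsFiniteMeasure (ν.withDensity e) := hfinite ν (h 1 one_pos ▸ hfin 1 one_pos)
  have heq : μ.withDensity e = ν.withDensity e := ext_of_measureLaplace_natCast fun n => by
    rw [measureLaplace_withDensity_exp, measureLaplace_withDensity_exp, h _ (by positivity)]
  have hinv : ∀ m : Measure ℝ≥0, (m.withDensity e).withDensity e⁻¹ = m := fun m =>
    withDensity_inv_same hem (ae_of_all _ fun x => (ENNReal.ofReal_pos.2 (Real.exp_pos _)).ne')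
      (ae_of_all _ fun _ => ENNReal.ofReal_ne_top)
  rw [← hinv μ, heq, hinv]

/-! ### Distribution functions -/

lemma tendsto_measure_Iio_nhdsLT (μ : Measure ℝ≥0) {t : ℝ≥0} (ht : 0 < t) :
    Tendsto (fun s => μ (Iio s)) (𝓝[<] t) (𝓝 (μ (Iio t))) := by
  obtain ⟨u, hu, hut, hlim⟩ := exists_seq_strictMono_tendsto' ht
  have hunion : ⋃ n, Iio (u n) = Iio t := by
    refine subset_antisymm (iUnion_subset fun n => Iio_subset_Iio (hut n).2.le) fun s hs => ?_
    obtain ⟨n, hn⟩ := (hlim.eventually_const_lt hs).exists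
    exact mem_iUnion.2 ⟨n, hn⟩
  have hseq : Tendsto (fun n => μ (Iio (u n))) atTop (𝓝 (μ (Iio t))) :=
    hunion ▸ tendsto_measure_iUnion_atTop fun m n hmn => Iio_subset_Iio (hu.monotone hmn)
  have hu_nhds : Tendsto u atTop (𝓝[<] t) :=
    tendsto_nhdsWithin_iff.2 ⟨hlim, Eventually.of_forall fun n => (hut n).2⟩
  have hlt := (monotone_measure_Iio μ).tendsto_nhdsLT t
  rwa [tendsto_nhds_unique (hlt.comp hu_nhds) hseq] at hlt

lemma frequently_nhdsLT_of_ae {P : ℝ≥0 → Prop} (h : ∀ᵐ t ∂lebesgue, P t) {t : ℝ≥0} (ht : 0 < t) :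
    ∃ᶠ s in 𝓝[<] t, P s := by
  rw [(nhdsLT_basis_of_exists_lt ⟨0, ht⟩).frequently_iff]
  intro a hat
  have hne : (Ioo a t).Nonempty := nonempty_Ioo.2 hat
  obtain ⟨s, hs, hPs⟩ := (Measure.dense_of_ae h).inter_open_nonempty _ isOpen_Ioo hne
  exact ⟨s, hs, hPs⟩

lemma eq_of_ae_eq_of_tendsto_nhdsLT {X : Type*} [TopologicalSpace X] [T2Space X] {f g : ℝ≥0 → X}
    (h : ∀ᵐ t ∂lebesgue, f t = g t) {t : ℝ≥0} (ht : 0 < t)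
    (hf : Tendsto f (𝓝[<] t) (𝓝 (f t))) (hg : Tendsto g (𝓝[<] t) (𝓝 (g t))) : f t = g t :=
  tendsto_nhds_unique_of_frequently_eq hf hg (frequently_nhdsLT_of_ae h ht)

lemma ae_lebesgue_of_ae {P : ℝ → Prop} (h : ∀ᵐ t, P t) : ∀ᵐ t : ℝ≥0 ∂lebesgue, P t :=
  ae_of_ae_map measurable_coe_nnreal_real.aemeasurable (map_coe_lebesgue ▸ ae_restrict_of_ae h)

lemma leftLim_stieltjesFunction_of_continuousAt {g : ℝ → ℝ} (hg : Monotone g) {t : ℝ}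
    (ht : ContinuousAt g t) : Function.leftLim hg.stieltjesFunction t = g t := by
  have hrl : ⇑hg.stieltjesFunction = Function.rightLim g := funext hg.stieltjesFunction_eq
  have hlim : Tendsto g (𝓝[<] t) (𝓝 (g t)) := ht.tendsto.mono_left nhdsWithin_le_nhds
  rw [hrl, leftLim_rightLim (hg.tendsto_leftLim t)]
  exact leftLim_eq_of_tendsto hlim

/-- Monotone functions are continuous off a countable set, hence are almost everywhere the
distribution function of their Stieltjes measure. -/
lemma exists_measure_Iio_ae_eq_of_monotone {g : ℝ → ℝ} (hg : Monotone g) (h0 : ∀ t ≤ 0, g t = 0)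
    {K : ℝ} (hK : ∀ t, g t ≤ K) :
    ∃ ν : Measure ℝ, ν univ ≤ ENNReal.ofReal K ∧ ∀ᵐ t, ν (Iio t) = ENNReal.ofReal (g t) := by
  set S := hg.stieltjesFunction with hS
  have hgS : ∀ t, g t ≤ S t := fun t => by
    rw [hS, hg.stieltjesFunction_eq]
    exact hg.le_rightLim le_rfl
  have hSg : ∀ s t, s < t → S s ≤ g t := fun s t hst => by
    rw [hS, hg.stieltjesFunction_eq]
    exact hg.rightLim_le hst
  have hbot : Tendsto S atBot (𝓝 0) := by
    refine tendsto_const_nhds.congr' ?_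
    filter_upwards [eventually_lt_atBot 0] with t ht
    exact le_antisymm ((h0 t ht.le).symm.trans_le (hgS t)) ((hSg t 0 ht).trans_eq (h0 0 le_rfl))
  have hSK : ∀ t, S t ≤ K := fun t => (hSg t _ (lt_add_one t)).trans (hK _)
  have htop := tendsto_atTop_ciSup S.mono ⟨K, by rintro _ ⟨t, rfl⟩; exact hSK t⟩
  refine ⟨S.measure, ?_, ?_⟩
  · rw [S.measure_univ hbot htop, sub_zero]
    exact ENNReal.ofReal_le_ofReal (ciSup_le hSK)
  · have hcont : ∀ᵐ t : ℝ, ContinuousAt g t := hg.countable_not_continuousAt.measure_zero volume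
    filter_upwards [hcont] with t ht
    rw [S.measure_Iio hbot, sub_zero, leftLim_stieltjesFunction_of_continuousAt hg ht]

lemma ae_lebesgue_pos : ∀ᵐ t ∂lebesgue, 0 < t := by
  simp [ae_iff]

lemma exists_measure_Iio_ae_eq {G : ℝ≥0 → ℝ≥0∞} (hG : Monotone G) {K : ℝ≥0} (hK : ∀ t, G t ≤ K) :
    ∃ ν : Measure ℝ≥0, ν univ ≤ K ∧ ∀ᵐ t ∂lebesgue, ν (Iio t) = G t := by
  have hfin : ∀ t, G t ≠ ⊤ := fun t => ((hK t).trans_lt ENNReal.coe_lt_top).ne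
  set g : ℝ → ℝ := fun t => if t ≤ 0 then 0 else (G t.toNNReal).toReal with hg_def
  have hg : Monotone g := fun s t hst => by
    simp only [hg_def]
    split_ifs with hs ht ht
    · rfl
    · exact ENNReal.toReal_nonneg
    · exact absurd (hst.trans ht) hs
    · exact ENNReal.toReal_mono (hfin _) (hG (Real.toNNReal_mono hst))
  have hgK : ∀ t, g t ≤ K := fun t => by
    simp only [hg_def]
    split_ifs
    · exact K.2
    · exact ENNReal.toReal_le_coe_of_le_coe (hK _)
  obtain ⟨ν, hνK, hν⟩ := exists_measure_Iio_ae_eq_of_monotone hg (fun t ht => if_pos ht) hgK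
  refine ⟨ν.map Real.toNNReal, ?_, ?_⟩
  · rwa [Measure.map_apply (by fun_prop) MeasurableSet.univ, preimage_univ,
      ← ENNReal.ofReal_coe_nnreal]
  · filter_upwards [ae_lebesgue_of_ae hν, ae_lebesgue_pos] with t ht ht0
    have hpre : Real.toNNReal ⁻¹' Iio t = Iio (t : ℝ) := by
      ext y
      simp [← NNReal.coe_lt_coe, Real.coe_toNNReal', ht0]
    have hgt : g t = (G t).toReal := by
      simp only [hg_def, if_neg (not_le.2 (NNReal.coe_pos.2 ht0)), Real.toNNReal_coe]
    rw [Measure.map_apply (by fun_prop) measurableSet_Iio, hpre, ht, hgt,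
      ENNReal.ofReal_toReal (hfin t)]

/-! ### Laplace exponents of nonincreasing densities -/

lemma measure_conv_univ (μ ν : Measure ℝ≥0) [SFinite ν] :
    (μ.conv ν) univ = μ univ * ν univ := by
  simpa [measureLaplace] using measureLaplace_conv μ ν 0

lemma conv_Iio_le_mul (μ ν : Measure ℝ≥0) [SFinite μ] [SFinite ν] (t : ℝ≥0) :
    (μ.conv ν) (Iio t) ≤ μ (Iio t) * ν (Iio t) := by
  rw [Measure.conv, Measure.map_apply (by fun_prop) measurableSet_Iio, ← Measure.prod_prod]
  exact measure_mono fun z (hz : z.1 + z.2 < t) =>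
    ⟨(le_self_add.trans_lt hz : z.1 < t), (le_add_self.trans_lt hz : z.2 < t)⟩

/-- The convolution powers of a measure on the half-line. -/
def convPow (ν : Measure ℝ≥0) : ℕ → Measure ℝ≥0
  | 0 => Measure.dirac 0
  | n + 1 => (convPow ν n).conv ν

lemma measureLaplace_convPow (ν : Measure ℝ≥0) [SFinite ν] (n : ℕ) (p : ℝ) :
    measureLaplace (convPow ν n) p = measureLaplace ν p ^ n := by
  induction n with
  | zero => rw [convPow, measureLaplace_dirac_zero, pow_zero]
  | succ n ih => rw [convPow, measureLaplace_conv, ih, pow_succ]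

lemma tsum_ofReal_exp_mul_pow (K : ℝ) {a : ℝ≥0∞} (ha : a ≠ ⊤) :
    ∑' n : ℕ, ENNReal.ofReal (Real.exp (-K) / n.factorial) * a ^ n =
      ENNReal.ofReal (Real.exp (-(K - a.toReal))) := by
  have hsum : HasSum (fun n : ℕ => Real.exp (-K) * (a.toReal ^ n / n.factorial))
      (Real.exp (-(K - a.toReal))) := by
    have := (NormedSpace.expSeries_div_hasSum_exp a.toReal).mul_left (Real.exp (-K))
    rwa [← Real.exp_eq_exp_ℝ, ← Real.exp_add, neg_add_eq_sub, ← neg_sub] at this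
  rw [← hsum.tsum_eq, ENNReal.ofReal_tsum_of_nonneg (fun n => by positivity) hsum.summable]
  refine tsum_congr fun n => ?_
  nth_rewrite 1 [← ENNReal.ofReal_toReal ha]
  rw [← ENNReal.ofReal_pow ENNReal.toReal_nonneg, ← ENNReal.ofReal_mul (by positivity)]
  ring_nf

/-- The measure is the compound Poisson law `e^{-K} ∑ ν^{*n} / n!`. -/
lemma exists_measureLaplace_eq_exp_sub (ν : Measure ℝ≥0) {K : ℝ≥0} (hν : ν univ ≤ K) :
    ∃ μ : Measure ℝ≥0, μ univ ≤ 1 ∧ ∀ p, 0 ≤ p →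
      measureLaplace μ p = ENNReal.ofReal (Real.exp (-(K - (measureLaplace ν p).toReal))) := by
  have : IsFiniteMeasure ν := ⟨hν.trans_lt ENNReal.coe_lt_top⟩
  set μ : Measure ℝ≥0 := Measure.sum fun n : ℕ =>
    ENNReal.ofReal (Real.exp (-K) / n.factorial) • convPow ν n with hμ_def
  have hle : ∀ p, 0 ≤ p → measureLaplace ν p ≤ K := fun p hp =>
    (measureLaplace_le_univ ν hp).trans hν
  have hμ : ∀ p, 0 ≤ p →
      measureLaplace μ p = ENNReal.ofReal (Real.exp (-(K - (measureLaplace ν p).toReal))) := by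
    intro p hp
    rw [← tsum_ofReal_exp_mul_pow _ ((hle p hp).trans_lt ENNReal.coe_lt_top).ne, hμ_def,
      measureLaplace, lintegral_sum_measure]
    refine tsum_congr fun n => ?_
    rw [lintegral_smul_measure, ← measureLaplace, measureLaplace_convPow, smul_eq_mul]
  refine ⟨μ, ?_, hμ⟩
  rw [show μ univ = measureLaplace μ 0 by simp [measureLaplace], hμ 0 le_rfl]
  exact ENNReal.ofReal_le_one.2 (Real.exp_le_one_iff.2 (neg_nonpos.2 (sub_nonneg.2
    (ENNReal.toReal_le_coe_of_le_coe (hle 0 le_rfl)))))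

lemma exists_measureLaplace_add_eq {f : ℝ≥0 → ℝ≥0∞} (hf : Antitone f) {K : ℝ≥0}
    (hK : ∀ t, f t ≤ K) :
    ∃ ν : Measure ℝ≥0, ν univ ≤ K ∧ ∀ p, 0 < p →
      measureLaplace ν p + ENNReal.ofReal p * measureLaplace (lebesgue.withDensity f) p = K := by
  obtain ⟨ν, hνK, hν⟩ := exists_measure_Iio_ae_eq (G := fun t => K - f t)
    (fun s t hst => tsub_le_tsub_left (hf hst) _) fun t => tsub_le_self
  have : IsFiniteMeasure ν := ⟨hνK.trans_lt ENNReal.coe_lt_top⟩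
  refine ⟨ν, hνK, fun p hp => ?_⟩
  have hfm := hf.measurable
  have hsum : ∀ᵐ t : ℝ≥0 ∂lebesgue, ENNReal.ofReal (Real.exp (-(p * t))) * ν (Iio t) +
      ENNReal.ofReal (Real.exp (-(p * t))) * f t = ENNReal.ofReal (Real.exp (-(p * t))) * K := by
    filter_upwards [hν] with t ht
    rw [ht, ← mul_add, tsub_add_cancel_of_le (hK t)]
  rw [measureLaplace_eq_mul_lintegral_Iio ν hp, measureLaplace_withDensity _ hfm.aemeasurable,
    ← mul_add, ← lintegral_add_right _ (by fun_prop), lintegral_congr_ae hsum,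
    lintegral_mul_const _ (by fun_prop), ← measureLaplace, measureLaplace_lebesgue hp, ← mul_assoc,
    ← ENNReal.ofReal_mul hp.le, mul_inv_cancel₀ hp.ne', ENNReal.ofReal_one, one_mul]

lemma exists_measureLaplace_eq_exp_of_le {f : ℝ≥0 → ℝ≥0∞} (hf : Antitone f) {K : ℝ≥0}
    (hK : ∀ t, f t ≤ K) :
    ∃ μ : Measure ℝ≥0, μ univ ≤ 1 ∧ ∀ p, 0 < p → measureLaplace μ p =
      ENNReal.ofReal (Real.exp (-(p * (measureLaplace (lebesgue.withDensity f) p).toReal))) := by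
  obtain ⟨ν, hνK, hν⟩ := exists_measureLaplace_add_eq hf hK
  obtain ⟨μ, hμ1, hμ⟩ := exists_measureLaplace_eq_exp_sub ν hνK
  refine ⟨μ, hμ1, fun p hp => ?_⟩
  have hfin := ENNReal.add_ne_top.1 ((hν p hp).trans_ne ENNReal.coe_ne_top)
  have hreal := congrArg ENNReal.toReal (hν p hp)
  rw [ENNReal.toReal_add hfin.1 hfin.2, ENNReal.toReal_mul, ENNReal.toReal_ofReal hp.le,
    ENNReal.coe_toReal] at hreal
  rw [hμ p hp.le, ← hreal, add_sub_cancel_left]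

lemma exists_measureLaplace_eq_iInf {μ : ℕ → Measure ℝ≥0} (hμ : ∀ n, μ n univ ≤ 1)
    (hanti : Antitone fun n t => μ n (Iio t)) :
    ∃ ν : Measure ℝ≥0, ν univ ≤ 1 ∧
      ∀ p, 0 < p → measureLaplace ν p = ⨅ n, measureLaplace (μ n) p := by
  obtain ⟨ν, hν1, hν⟩ := exists_measure_Iio_ae_eq (G := fun t => ⨅ n, μ n (Iio t)) (K := 1)
    (fun s t hst => iInf_mono fun n => monotone_measure_Iio (μ n) hst)
    fun t => (iInf_le _ 0).trans ((measure_mono (subset_univ _)).trans (hμ 0))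
  have : ∀ n, IsFiniteMeasure (μ n) := fun n => ⟨(hμ n).trans_lt ENNReal.one_lt_top⟩
  have : IsFiniteMeasure ν := ⟨hν1.trans_lt ENNReal.coe_lt_top⟩
  refine ⟨ν, hν1, fun p hp => ?_⟩
  have hmeas : ∀ n, Measurable fun t : ℝ≥0 =>
      ENNReal.ofReal (Real.exp (-(p * t))) * μ n (Iio t) := fun n =>
    .mul (by fun_prop) (monotone_measure_Iio (μ n)).measurable
  have hpull : ∀ᵐ t : ℝ≥0 ∂lebesgue, ENNReal.ofReal (Real.exp (-(p * t))) * ν (Iio t) =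
      ⨅ n, ENNReal.ofReal (Real.exp (-(p * t))) * μ n (Iio t) := by
    filter_upwards [hν] with t ht
    rw [ht, ENNReal.mul_iInf_of_ne (ENNReal.ofReal_pos.2 (Real.exp_pos _)).ne'
      ENNReal.ofReal_ne_top]
  have hfin : ∫⁻ t : ℝ≥0, ENNReal.ofReal (Real.exp (-(p * t))) * μ 0 (Iio t) ∂lebesgue ≠ ⊤ := by
    refine ne_top_of_le_ne_top ENNReal.ofReal_ne_top
      ((lintegral_mono fun t => ?_).trans_eq (measureLaplace_lebesgue hp))
    exact mul_le_of_le_one_right' ((measure_mono (subset_univ _)).trans (hμ 0))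
  simp_rw [measureLaplace_eq_mul_lintegral_Iio _ hp]
  rw [lintegral_congr_ae hpull, lintegral_iInf hmeas
    (fun m n hmn t => mul_le_mul_right (hanti hmn t) _) hfin,
    ENNReal.mul_iInf_of_ne (ENNReal.ofReal_pos.2 hp).ne' ENNReal.ofReal_ne_top]

lemma measureLaplace_le_of_measure_Iio_le {μ ν : Measure ℝ≥0} [SFinite μ] [SFinite ν]
    (h : ∀ t, μ (Iio t) ≤ ν (Iio t)) {p : ℝ} (hp : 0 < p) :
    measureLaplace μ p ≤ measureLaplace ν p := by
  rw [measureLaplace_eq_mul_lintegral_Iio _ hp, measureLaplace_eq_mul_lintegral_Iio _ hp]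
  exact mul_le_mul_right (lintegral_mono fun t => mul_le_mul_right (h t) _) _

lemma exists_tendsto_prod_measureLaplace {κ : ℕ → Measure ℝ≥0} (hκ : ∀ n, κ n univ ≤ 1) :
    ∃ ν : Measure ℝ≥0, ν univ ≤ 1 ∧ ∀ p, 0 < p → Tendsto
      (fun n => ∏ i ∈ Finset.range n, measureLaplace (κ i) p) atTop (𝓝 (measureLaplace ν p)) := by
  have : ∀ n, IsFiniteMeasure (κ n) := fun n => ⟨(hκ n).trans_lt ENNReal.one_lt_top⟩
  obtain ⟨μ, hμ_zero, hμ_succ⟩ : ∃ μ : ℕ → Measure ℝ≥0, μ 0 = Measure.dirac 0 ∧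
      ∀ n, μ (n + 1) = (μ n).conv (κ n) :=
    ⟨fun n => n.rec (Measure.dirac 0) fun n m => m.conv (κ n), rfl, fun _ => rfl⟩
  have hμ1 : ∀ n, μ n univ ≤ 1 := fun n => by
    induction n with
    | zero => simp [hμ_zero]
    | succ n ih => rw [hμ_succ, measure_conv_univ]; exact mul_le_one' ih (hκ n)
  have : ∀ n, IsFiniteMeasure (μ n) := fun n => ⟨(hμ1 n).trans_lt ENNReal.one_lt_top⟩
  have hμ : ∀ n p, measureLaplace (μ n) p = ∏ i ∈ Finset.range n, measureLaplace (κ i) p :=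
    fun n p => by
      induction n with
      | zero => simp [hμ_zero, measureLaplace_dirac_zero]
      | succ n ih => rw [hμ_succ, measureLaplace_conv, ih, Finset.prod_range_succ]
  have hanti : Antitone fun n t => μ n (Iio t) := antitone_nat_of_succ_le fun n t => by
    rw [hμ_succ]
    refine (conv_Iio_le_mul (μ n) (κ n) t).trans (mul_le_of_le_one_right' ?_)
    exact (measure_mono (subset_univ _)).trans (hκ n)
  obtain ⟨ν, hν1, hν⟩ := exists_measureLaplace_eq_iInf hμ1 hanti
  refine ⟨ν, hν1, fun p hp => ?_⟩
  have hlap_anti : Antitone fun n => measureLaplace (μ n) p := fun m n hmn =>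
    measureLaplace_le_of_measure_Iio_le (hanti hmn) hp
  simp_rw [hν p hp, ← hμ]
  exact tendsto_atTop_iInf hlap_anti

lemma sum_range_min_tsub_one (a : ℝ≥0∞) (N : ℕ) :
    ∑ n ∈ Finset.range N, min (a - n) 1 = min a N := by
  induction N with
  | zero => simp
  | succ N ih =>
    rw [Finset.sum_range_succ, ih, Nat.cast_succ]
    rcases le_total a N with h | h
    · rw [tsub_eq_zero_of_le h, min_eq_left h, min_eq_left (h.trans le_self_add)]
      simp
    · nth_rewrite 3 [← add_tsub_cancel_of_le h]
      rw [min_eq_right h, min_add_add_left]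

lemma tsum_min_tsub_one (a : ℝ≥0∞) : ∑' n : ℕ, min (a - n) 1 = a := by
  simp_rw [ENNReal.tsum_eq_iSup_nat, sum_range_min_tsub_one]
  rw [← inf_iSup_eq, ENNReal.iSup_natCast, inf_top_eq]

/-- Slicing `f` into the layers `min (f - n) 1` writes `μ` as an infinite convolution product. -/
theorem exists_measureLaplace_eq_exp {f : ℝ≥0 → ℝ≥0∞} (hf : Antitone f)
    (hfin : ∀ p, 0 < p → measureLaplace (lebesgue.withDensity f) p ≠ ⊤) :
    ∃ μ : Measure ℝ≥0, μ univ ≤ 1 ∧ ∀ p, 0 < p → measureLaplace μ p =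
      ENNReal.ofReal (Real.exp (-(p * (measureLaplace (lebesgue.withDensity f) p).toReal))) := by
  set layer : ℕ → ℝ≥0 → ℝ≥0∞ := fun n t => min (f t - n) 1
  have hlayer : ∀ n, Antitone (layer n) := fun n s t hst =>
    min_le_min_right _ (tsub_le_tsub_right (hf hst) _)
  set φ : ℕ → ℝ → ℝ≥0∞ := fun n p => measureLaplace (lebesgue.withDensity (layer n)) p
  have hφ : ∀ p, measureLaplace (lebesgue.withDensity f) p = ∑' n, φ n p := fun p => by
    have hf_tsum : f = ∑' n, layer n := by
      ext t
      rw [ENNReal.tsum_apply, tsum_min_tsub_one]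
    rw [hf_tsum, withDensity_tsum fun n => (hlayer n).measurable, measureLaplace,
      lintegral_sum_measure]
    rfl
  choose κ hκ1 hκ using fun n => exists_measureLaplace_eq_exp_of_le (hlayer n) (K := 1)
    fun t => min_le_right _ _
  obtain ⟨μ, hμ1, hμ⟩ := exists_tendsto_prod_measureLaplace hκ1
  refine ⟨μ, hμ1, fun p hp => tendsto_nhds_unique (hμ p hp) ?_⟩
  have hprod : ∀ n, ∏ i ∈ Finset.range n, measureLaplace (κ i) p =
      ENNReal.ofReal (Real.exp (-(p * ∑ i ∈ Finset.range n, (φ i p).toReal))) := fun n => by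
    rw [Finset.mul_sum, ← Finset.sum_neg_distrib, Real.exp_sum,
      ENNReal.ofReal_prod_of_nonneg fun i _ => (Real.exp_pos _).le]
    exact Finset.prod_congr rfl fun i _ => hκ i p hp
  have hfin' : ∑' n, φ n p ≠ ⊤ := hφ p ▸ hfin p hp
  simp_rw [hprod]
  rw [hφ, ENNReal.tsum_toReal_eq (ENNReal.ne_top_of_tsum_ne_top hfin')]
  have hsum := (ENNReal.summable_toReal hfin').hasSum.tendsto_sum_nat
  exact ENNReal.tendsto_ofReal ((Real.continuous_exp.tendsto _).comp (hsum.const_mul p).neg)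

/-! ### Propagation functions -/

/-- The measure on the half-line whose density is the positive part of `f`. -/
def densityMeasure (f : ℝ → ℝ) : Measure ℝ≥0 :=
  lebesgue.withDensity fun t => ENNReal.ofReal (f t)

instance (f : ℝ → ℝ) : SigmaFinite (densityMeasure f) := SigmaFinite.withDensity_ofReal _

lemma densityMeasure_eq_withDensity {g : ℝ → ℝ} {f : ℝ≥0 → ℝ≥0∞}
    (h : ∀ t, 0 < t → f t = ENNReal.ofReal (g t)) : densityMeasure g = lebesgue.withDensity f :=
  withDensity_congr_ae (ae_lebesgue_pos.mono fun t ht => (h t ht).symm)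

lemma aemeasurable_comp_coe_lebesgue {f : ℝ → ℝ} (hf : AEMeasurable f (volume.restrict (Ioi 0))) :
    AEMeasurable (fun t : ℝ≥0 => f t) lebesgue :=
  (map_coe_lebesgue ▸ hf).comp_measurable measurable_coe_nnreal_real

lemma measureLaplace_densityMeasure {f : ℝ → ℝ} (hf : AEMeasurable f (volume.restrict (Ioi 0)))
    (p : ℝ) : measureLaplace (densityMeasure f) p =
      ∫⁻ σ in Ioi (0 : ℝ), ENNReal.ofReal (Real.exp (-(p * σ)) * f σ) := by
  rw [densityMeasure,
    measureLaplace_withDensity _ (aemeasurable_comp_coe_lebesgue hf).ennreal_ofReal,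
    ← lintegral_coe_lebesgue fun σ => ENNReal.ofReal (Real.exp (-(p * σ)) * f σ)]
  exact lintegral_congr fun t => (ENNReal.ofReal_mul (Real.exp_pos _).le).symm

lemma measureLaplace_densityMeasure_eq_ofReal {f : ℝ → ℝ}
    (hf : AEMeasurable f (volume.restrict (Ioi 0))) (h0 : ∀ t, 0 < t → 0 ≤ f t) {p : ℝ}
    (hint : IntegrableOn (fun σ => Real.exp (-(p * σ)) * f σ) (Ioi 0)) :
    measureLaplace (densityMeasure f) p = ENNReal.ofReal (laplace f p) := by
  rw [measureLaplace_densityMeasure hf, laplace, ofReal_integral_eq_lintegral_ofReal hint]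
  filter_upwards [ae_restrict_mem measurableSet_Ioi] with t ht
  exact mul_nonneg (Real.exp_pos _).le (h0 t ht)

lemma integrableOn_exp_mul_of_le {f : ℝ → ℝ} {C p a : ℝ} (hp : 0 < p)
    (hf : AEMeasurable f (volume.restrict (Ioi a))) (hC : ∀ t, a < t → |f t| ≤ C) :
    IntegrableOn (fun σ => Real.exp (-(p * σ)) * f σ) (Ioi a) := by
  refine Integrable.mul_bdd (c := C) (by simpa [IntegrableOn] using exp_neg_integrableOn_Ioi a hp)
    hf.aestronglyMeasurable ?_
  filter_upwards [ae_restrict_mem measurableSet_Ioi] with t ht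
  exact hC t ht

/-- Nonnegative nonincreasing kernels on `(0,∞)` that are integrable near `0`: the kernels `k` of
pairs `(k, ℓ)` of type `(PC)`. -/
structure IsMemoryKernel (k : ℝ → ℝ) : Prop where
  integrableOn : IntegrableOn k (Ioc 0 1)
  nonneg : ∀ t, 0 < t → 0 ≤ k t
  antitoneOn : AntitoneOn k (Ioi 0)

lemma IsPC.isMemoryKernel {k ℓ : ℝ → ℝ} (h : IsPC k ℓ) : IsMemoryKernel k :=
  ⟨h.locallyIntegrable_k 1 one_pos, h.nonneg_k, h.antitone_k⟩

namespace IsMemoryKernel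

variable {k : ℝ → ℝ} (hk : IsMemoryKernel k)

include hk

lemma aemeasurable : AEMeasurable k (volume.restrict (Ioi 0)) :=
  aemeasurable_restrict_of_antitoneOn measurableSet_Ioi hk.antitoneOn

lemma integrableOn_exp_mul {p : ℝ} (hp : 0 < p) :
    IntegrableOn (fun σ => Real.exp (-(p * σ)) * k σ) (Ioi 0) := by
  rw [← Ioc_union_Ioi_eq_Ioi (zero_le_one' ℝ)]
  refine IntegrableOn.union ?_ ?_
  · refine Integrable.bdd_mul (c := 1) hk.integrableOn (by fun_prop) ?_
    filter_upwards [ae_restrict_mem measurableSet_Ioc] with t ht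
    rw [Real.norm_eq_abs, Real.abs_exp, Real.exp_le_one_iff]
    exact neg_nonpos.2 (mul_nonneg hp.le ht.1.le)
  · refine integrableOn_exp_mul_of_le (C := k 1) hp
      (hk.aemeasurable.mono_set (Ioi_subset_Ioi zero_le_one)) fun t ht => ?_
    have h0 : 0 < t := one_pos.trans ht
    rw [abs_of_nonneg (hk.nonneg t h0)]
    exact hk.antitoneOn (mem_Ioi.2 one_pos) (mem_Ioi.2 h0) ht.le

lemma laplace_nonneg (p : ℝ) : 0 ≤ laplace k p :=
  setIntegral_nonneg measurableSet_Ioi fun t ht => mul_nonneg (Real.exp_pos _).le (hk.nonneg t ht)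

lemma const_mul {τ : ℝ} (hτ : 0 ≤ τ) : IsMemoryKernel fun t => τ * k t :=
  ⟨hk.integrableOn.const_mul τ, fun t ht => mul_nonneg hτ (hk.nonneg t ht),
    fun _ hs _ ht hst => mul_le_mul_of_nonneg_left (hk.antitoneOn hs ht hst) hτ⟩

lemma measureLaplace_densityMeasure {p : ℝ} (hp : 0 < p) :
    measureLaplace (densityMeasure k) p = ENNReal.ofReal (laplace k p) :=
  measureLaplace_densityMeasure_eq_ofReal hk.aemeasurable hk.nonneg (hk.integrableOn_exp_mul hp)

lemma exists_antitone :
    ∃ f : ℝ≥0 → ℝ≥0∞, Antitone f ∧ ∀ t, 0 < t → f t = ENNReal.ofReal (k t) := by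
  refine ⟨fun t => if t = 0 then ⊤ else ENNReal.ofReal (k t), fun s t hst => ?_, fun t ht =>
    if_neg ht.ne'⟩
  rcases eq_or_ne s 0 with rfl | hs
  · simp
  · have hs' := pos_iff_ne_zero.2 hs
    have ht' := hs'.trans_le hst
    simp only [hs, ht'.ne', if_false]
    exact ENNReal.ofReal_le_ofReal
      (hk.antitoneOn (NNReal.coe_pos.2 hs') (NNReal.coe_pos.2 ht') hst)

lemma exists_measureLaplace_eq_exp : ∃ μ : Measure ℝ≥0, μ univ ≤ 1 ∧ ∀ p, 0 < p →
    measureLaplace μ p = ENNReal.ofReal (Real.exp (-(p * laplace k p))) := by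
  obtain ⟨f, hf, hfk⟩ := hk.exists_antitone
  have hlap : ∀ p, 0 < p →
      measureLaplace (lebesgue.withDensity f) p = ENNReal.ofReal (laplace k p) := fun p hp => by
    rw [← densityMeasure_eq_withDensity hfk, hk.measureLaplace_densityMeasure hp]
  obtain ⟨μ, hμ1, hμ⟩ := NonlocalDiffusion.exists_measureLaplace_eq_exp hf fun p hp =>
    (hlap p hp).trans_ne ENNReal.ofReal_ne_top
  refine ⟨μ, hμ1, fun p hp => ?_⟩
  rw [hμ p hp, hlap p hp, ENNReal.toReal_ofReal (hk.laplace_nonneg p)]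

end IsMemoryKernel

lemma laplace_const_mul (τ : ℝ) (f : ℝ → ℝ) (p : ℝ) :
    laplace (fun t => τ * f t) p = τ * laplace f p := by
  simp only [laplace, mul_left_comm _ τ, integral_const_mul]

/-- Convolution semigroups `(μ τ)` of sub-probability measures on the half-line with Laplace
exponent `φ`, that is, the laws of (killed) subordinators. -/
structure IsSubordinator (φ : ℝ → ℝ) (μ : ℝ≥0 → Measure ℝ≥0) : Prop where
  univ_le_one : ∀ τ, μ τ univ ≤ 1
  laplace_eq : ∀ (τ : ℝ≥0) (p : ℝ), 0 < p →
    measureLaplace (μ τ) p = ENNReal.ofReal (Real.exp (-(τ * φ p)))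

theorem IsMemoryKernel.exists_isSubordinator {k : ℝ → ℝ} (hk : IsMemoryKernel k) :
    ∃ μ, IsSubordinator (fun p => p * laplace k p) μ := by
  choose μ hμ1 hμ using fun τ : ℝ≥0 => (hk.const_mul τ.2).exists_measureLaplace_eq_exp
  refine ⟨μ, hμ1, fun τ p hp => ?_⟩
  rw [hμ τ p hp, laplace_const_mul, mul_left_comm]
  rfl

/-- The distribution function `σ ↦ μ[0, σ)` of a measure on the half-line, as a real function. -/
def cdfIio (μ : Measure ℝ≥0) (σ : ℝ) : ℝ := (μ (Iio σ.toNNReal)).toReal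

lemma cdfIio_le_one {μ : Measure ℝ≥0} (hμ : μ univ ≤ 1) (σ : ℝ) : cdfIio μ σ ≤ 1 :=
  ENNReal.toReal_le_of_le_ofReal zero_le_one
    (ENNReal.ofReal_one ▸ (measure_mono (subset_univ _)).trans hμ)

section FiniteMeasure

variable (μ : Measure ℝ≥0) [IsFiniteMeasure μ]

lemma monotone_cdfIio : Monotone (cdfIio μ) := fun _ _ hst =>
  ENNReal.toReal_mono (measure_ne_top _ _)
    (measure_mono (Iio_subset_Iio (Real.toNNReal_mono hst)))

lemma tendsto_cdfIio_nhdsLT {σ : ℝ} (hσ : 0 < σ) :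
    Tendsto (cdfIio μ) (𝓝[<] σ) (𝓝 (cdfIio μ σ)) := by
  have hmaps : Tendsto Real.toNNReal (𝓝[<] σ) (𝓝[<] σ.toNNReal) :=
    continuous_real_toNNReal.continuousWithinAt.tendsto_nhdsWithin fun s hs =>
      (Real.toNNReal_lt_toNNReal_iff hσ).2 hs
  exact (ENNReal.tendsto_toReal (measure_ne_top _ _)).comp
    ((tendsto_measure_Iio_nhdsLT μ (Real.toNNReal_pos.2 hσ)).comp hmaps)

lemma laplace_cdfIio {p : ℝ} (hp : 0 < p) :
    laplace (cdfIio μ) p = (measureLaplace μ p).toReal / p := by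
  have hnonneg : ∀ σ, 0 ≤ Real.exp (-(p * σ)) * cdfIio μ σ := fun σ =>
    mul_nonneg (Real.exp_pos _).le ENNReal.toReal_nonneg
  have hm : Measurable (cdfIio μ) := (monotone_cdfIio μ).measurable
  have hcongr : ∀ t : ℝ≥0, ENNReal.ofReal (Real.exp (-(p * t)) * cdfIio μ t) =
      ENNReal.ofReal (Real.exp (-(p * t))) * μ (Iio t) := fun t => by
    rw [ENNReal.ofReal_mul (Real.exp_pos _).le, cdfIio, Real.toNNReal_coe,
      ENNReal.ofReal_toReal (measure_ne_top _ _)]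
  rw [laplace, integral_eq_lintegral_of_nonneg_ae (ae_of_all _ hnonneg)
    (Measurable.aestronglyMeasurable (by fun_prop)),
    ← lintegral_coe_lebesgue fun σ => ENNReal.ofReal (Real.exp (-(p * σ)) * cdfIio μ σ),
    lintegral_congr hcongr, measureLaplace_eq_mul_lintegral_Iio μ hp, ENNReal.toReal_mul,
    ENNReal.toReal_ofReal hp.le, mul_div_cancel_left₀ _ hp.ne']

end FiniteMeasure

lemma IsSubordinator.isFiniteMeasure {φ : ℝ → ℝ} {μ : ℝ≥0 → Measure ℝ≥0} (h : IsSubordinator φ μ)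
    (τ : ℝ≥0) : IsFiniteMeasure (μ τ) :=
  ⟨(h.univ_le_one τ).trans_lt ENNReal.one_lt_top⟩

lemma IsSubordinator.isPropagation_cdfIio {k : ℝ → ℝ} {μ : ℝ≥0 → Measure ℝ≥0}
    (h : IsSubordinator (fun p => p * laplace k p) μ) (τ : ℝ≥0) :
    IsPropagation k τ (cdfIio (μ τ)) := by
  have := h.isFiniteMeasure τ
  have hmono := monotone_cdfIio (μ τ)
  refine ⟨hmono.monotoneOn _, ?_, ?_, fun σ hσ => ?_, fun p hp => ?_⟩
  · refine (hmono.monotoneOn _).boundedVariationOn (C := 1) fun σ _ => ?_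
    exact (abs_of_nonneg ENNReal.toReal_nonneg).trans_le (cdfIio_le_one (h.univ_le_one τ) σ)
  · simp [cdfIio]
  · exact continuousWithinAt_Iio_iff_Iic.1 (tendsto_cdfIio_nhdsLT (μ τ) hσ)
  · rw [laplace_cdfIio _ hp, h.laplace_eq τ p hp, ENNReal.toReal_ofReal (Real.exp_pos _).le]

namespace IsPropagation

variable {k : ℝ → ℝ} {τ : ℝ} {v v' : ℝ → ℝ}

lemma nonneg (h : IsPropagation k τ v) {σ : ℝ} (hσ : 0 ≤ σ) : 0 ≤ v σ :=
  h.zero.symm.trans_le (h.mono self_mem_Ici hσ hσ)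

lemma aemeasurable (h : IsPropagation k τ v) : AEMeasurable v (volume.restrict (Ioi 0)) :=
  aemeasurable_restrict_of_monotoneOn measurableSet_Ioi (h.mono.mono Ioi_subset_Ici_self)

lemma measureLaplace_densityMeasure (h : IsPropagation k τ v) {p : ℝ} (hp : 0 < p) :
    measureLaplace (densityMeasure v) p =
      ENNReal.ofReal (Real.exp (-(τ * (p * laplace k p))) / p) := by
  rw [← h.laplace_eq p hp]
  refine measureLaplace_densityMeasure_eq_ofReal h.aemeasurable (fun t ht => h.nonneg ht.le)
    (integrableOn_exp_mul_of_le (C := (eVariationOn v (Ici 0)).toReal) hp h.aemeasurable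
      fun t ht => ?_)
  have hle := h.bv.sub_le (x := t) (y := 0) ht.le self_mem_Ici
  rwa [h.zero, sub_zero, ← abs_of_nonneg (h.nonneg ht.le)] at hle

lemma tendsto_coe_nhdsLT (h : IsPropagation k τ v) {t : ℝ≥0} (ht : 0 < t) :
    Tendsto (fun s : ℝ≥0 => v s) (𝓝[<] t) (𝓝 (v t)) := by
  have hcoe : Tendsto ((↑) : ℝ≥0 → ℝ) (𝓝[<] t) (𝓝[<] (t : ℝ)) :=
    NNReal.continuous_coe.continuousWithinAt.tendsto_nhdsWithin fun s hs => NNReal.coe_lt_coe.2 hs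
  exact (continuousWithinAt_Iio_iff_Iic.2 (h.leftCont t (NNReal.coe_pos.2 ht))).tendsto.comp hcoe

theorem eqOn (h : IsPropagation k τ v) (h' : IsPropagation k τ v') : EqOn v v' (Ici 0) := by
  have hmeasure : densityMeasure v = densityMeasure v' := by
    refine ext_of_measureLaplace (fun p hp => ?_) fun p hp => ?_
    · exact (h.measureLaplace_densityMeasure hp).trans_ne ENNReal.ofReal_ne_top
    · rw [h.measureLaplace_densityMeasure hp, h'.measureLaplace_densityMeasure hp]
  have hae := (withDensity_eq_iff_of_sigmaFinite
    (aemeasurable_comp_coe_lebesgue h.aemeasurable).ennreal_ofReal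
    (aemeasurable_comp_coe_lebesgue h'.aemeasurable).ennreal_ofReal).1 hmeasure
  have hae' : ∀ᵐ t : ℝ≥0 ∂lebesgue, v t = v' t := hae.mono fun t ht =>
    (ENNReal.ofReal_eq_ofReal_iff (h.nonneg t.2) (h'.nonneg t.2)).1 ht
  intro t ht
  lift t to ℝ≥0 using ht
  rcases eq_or_ne t 0 with rfl | ht0
  · rw [NNReal.coe_zero, h.zero, h'.zero]
  · have ht0' := pos_iff_ne_zero.2 ht0
    exact eq_of_ae_eq_of_tendsto_nhdsLT (f := fun t : ℝ≥0 => v t) (g := fun t : ℝ≥0 => v' t) hae'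
      ht0' (h.tendsto_coe_nhdsLT ht0') (h'.tendsto_coe_nhdsLT ht0')

end IsPropagation

theorem IsSubordinator.propagation_eq {k : ℝ → ℝ} {μ : ℝ≥0 → Measure ℝ≥0}
    (h : IsSubordinator (fun p => p * laplace k p) μ) (τ t : ℝ≥0) :
    propagation k t τ = (μ τ (Iio t)).toReal := by
  have hex : ∃ w : ℝ → ℝ → ℝ, ∀ τ : ℝ, 0 ≤ τ → IsPropagation k τ fun σ => w σ τ := by
    refine ⟨fun σ τ => cdfIio (μ τ.toNNReal) σ, fun τ hτ => ?_⟩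
    lift τ to ℝ≥0 using hτ
    simpa only [Real.toNNReal_coe] using h.isPropagation_cdfIio τ
  have hspec : IsPropagation k τ fun σ => propagation k σ τ := by
    rw [propagation, dif_pos hex]
    exact hex.choose_spec τ τ.2
  have heq := hspec.eqOn (h.isPropagation_cdfIio τ) (mem_Ici.2 t.coe_nonneg)
  rwa [cdfIio, Real.toNNReal_coe] at heq

/-! ### The potential measure of a subordinator -/

lemma measure_Iio_ne_top_of_measureLaplace_ne_top {ν : Measure ℝ≥0} {p : ℝ} (hp : 0 ≤ p)
    (h : measureLaplace ν p ≠ ⊤) (t : ℝ≥0) : ν (Iio t) ≠ ⊤ := by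
  have hmarkov : ENNReal.ofReal (Real.exp (-(p * t))) * ν (Iio t) ≤ measureLaplace ν p := by
    rw [← setLIntegral_const]
    refine (setLIntegral_mono (by fun_prop) fun x hx => ?_).trans (setLIntegral_le_lintegral _ _)
    gcongr
    exact (mem_Iio.1 hx).le
  exact fun htop => h (top_le_iff.1 (by
    rwa [htop, ENNReal.mul_top (ENNReal.ofReal_pos.2 (Real.exp_pos _)).ne'] at hmarkov))

lemma sigmaFinite_of_measureLaplace_ne_top {ν : Measure ℝ≥0} {p : ℝ} (hp : 0 ≤ p)
    (h : measureLaplace ν p ≠ ⊤) : SigmaFinite ν :=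
  ⟨⟨⟨fun n => Iio (n : ℝ≥0), fun _ => trivial,
    fun n => (measure_Iio_ne_top_of_measureLaplace_ne_top hp h n).lt_top,
    iUnion_eq_univ_iff.2 exists_nat_gt⟩⟩⟩

namespace IsSubordinator

variable {φ : ℝ → ℝ} {μ : ℝ≥0 → Measure ℝ≥0} (h : IsSubordinator φ μ)

include h

lemma add (a b : ℝ≥0) : μ (a + b) = (μ a).conv (μ b) := by
  have := h.isFiniteMeasure
  refine ext_of_measureLaplace (fun p hp => ?_) fun p hp => ?_
  · exact (h.laplace_eq _ p hp).trans_ne ENNReal.ofReal_ne_top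
  · rw [measureLaplace_conv, h.laplace_eq _ p hp, h.laplace_eq _ p hp, h.laplace_eq _ p hp,
      ← ENNReal.ofReal_mul (Real.exp_pos _).le, ← Real.exp_add, NNReal.coe_add, add_mul, neg_add]

lemma Iio_add_le_mul (a b t : ℝ≥0) : μ (a + b) (Iio t) ≤ μ a (Iio t) * μ b (Iio t) := by
  have := h.isFiniteMeasure
  exact h.add a b ▸ conv_Iio_le_mul _ _ _

lemma Iio_le_one (τ t : ℝ≥0) : μ τ (Iio t) ≤ 1 :=
  (measure_mono (subset_univ _)).trans (h.univ_le_one τ)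

lemma Iio_ne_top (τ t : ℝ≥0) : μ τ (Iio t) ≠ ⊤ :=
  ((h.Iio_le_one τ t).trans_lt ENNReal.one_lt_top).ne

lemma antitone_Iio (t : ℝ≥0) : Antitone fun τ => μ τ (Iio t) := fun a b hab => by
  have hle := h.Iio_add_le_mul a (b - a) t
  rw [add_tsub_cancel_of_le hab] at hle
  exact hle.trans (mul_le_of_le_one_right' (h.Iio_le_one _ t))

lemma antitone_univ : Antitone fun τ => μ τ univ := fun a b hab => by
  have := h.isFiniteMeasure
  have heq := h.add a (b - a)
  rw [add_tsub_cancel_of_le hab] at heq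
  change μ b univ ≤ μ a univ
  rw [heq, measure_conv_univ]
  exact mul_le_of_le_one_right' (h.univ_le_one _)

lemma measurable : Measurable μ := by
  have := h.isFiniteMeasure
  refine .measure_of_isPiSystem ((borel_eq_generateFrom_Iio ℝ≥0).symm ▸ BorelSpace.measurable_eq)
    isPiSystem_Iio ?_ h.antitone_univ.measurable
  rintro _ ⟨t, rfl⟩
  exact (h.antitone_Iio t).measurable

end IsSubordinator

/-- The potential measure `U = ∫₀^∞ μ_τ dτ` of a family of measures on the half-line. -/
def potential (μ : ℝ≥0 → Measure ℝ≥0) : Measure ℝ≥0 := lebesgue.bind μ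

namespace IsSubordinator

variable {φ : ℝ → ℝ} {μ : ℝ≥0 → Measure ℝ≥0} (h : IsSubordinator φ μ)

include h

lemma potential_Iio (t : ℝ≥0) : potential μ (Iio t) = ∫⁻ τ, μ τ (Iio t) ∂lebesgue :=
  Measure.bind_apply measurableSet_Iio h.measurable.aemeasurable

lemma measureLaplace_potential {p : ℝ} (hp : 0 < p) (hφ : 0 < φ p) :
    measureLaplace (potential μ) p = ENNReal.ofReal (φ p)⁻¹ := by
  rw [measureLaplace, potential, Measure.lintegral_bind h.measurable.aemeasurable (by fun_prop),
    ← measureLaplace_lebesgue hφ, measureLaplace]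
  refine lintegral_congr fun τ => ?_
  rw [← measureLaplace, h.laplace_eq τ p hp, mul_comm]

lemma sigmaFinite_potential {p : ℝ} (hp : 0 < p) (hφ : 0 < φ p) : SigmaFinite (potential μ) :=
  sigmaFinite_of_measureLaplace_ne_top hp.le
    ((h.measureLaplace_potential hp hφ).trans_ne ENNReal.ofReal_ne_top)

end IsSubordinator

lemma IsMemoryKernel.densityMeasure_conv {k m : ℝ → ℝ} (hk : IsMemoryKernel k)
    (hm : AEMeasurable m (volume.restrict (Ioi 0))) :
    (densityMeasure k).conv (densityMeasure m) = lebesgue.withDensity fun t =>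
      ∫⁻ s in Ioo (0 : ℝ) t, ENNReal.ofReal (k (t - s) * m s) := by
  obtain ⟨f, hf, hfk⟩ := hk.exists_antitone
  rw [densityMeasure_eq_withDensity hfk, lebesgue_withDensity_conv hf.measurable]
  congr with t
  have hft : Measurable fun s => f (t - s) :=
    hf.measurable.comp (measurable_const.sub measurable_id)
  rw [densityMeasure, ← setLIntegral_Iio_lebesgue fun s => ENNReal.ofReal (k (t - s) * m s),
    restrict_withDensity measurableSet_Iio, lintegral_withDensity_eq_lintegral_mul₀
      (aemeasurable_comp_coe_lebesgue hm).ennreal_ofReal.restrict hft.aemeasurable]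
  refine setLIntegral_congr_fun measurableSet_Iio fun s hs => ?_
  have hst : 0 < t - s := tsub_pos_of_lt hs
  rw [Pi.mul_apply, hfk _ hst, mul_comm, NNReal.coe_sub (le_of_lt hs),
    ENNReal.ofReal_mul (NNReal.coe_sub (le_of_lt hs) ▸ hk.nonneg _ hst)]

lemma timeConv_eq_setIntegral_Ioo (f g : ℝ → ℝ) {t : ℝ} (ht : 0 ≤ t) :
    timeConv f g t = ∫ s in Ioo 0 t, f (t - s) * g s := by
  rw [timeConv, intervalIntegral.integral_of_le ht, integral_Ioc_eq_integral_Ioo]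

lemma lintegral_ofReal_eq_ofReal_integral_add {α : Type*} [MeasurableSpace α] {μ : Measure α}
    {f : α → ℝ} (hf : Integrable f μ) (h0 : 0 ≤ ∫ x, f x ∂μ) :
    ∫⁻ x, ENNReal.ofReal (f x) ∂μ =
      ENNReal.ofReal (∫ x, f x ∂μ) + ∫⁻ x, ENNReal.ofReal (-f x) ∂μ := by
  have hpos : ∫⁻ x, ENNReal.ofReal (f x) ∂μ ≠ ⊤ := hf.lintegral_lt_top.ne
  have hneg : ∫⁻ x, ENNReal.ofReal (-f x) ∂μ ≠ ⊤ := hf.neg.lintegral_lt_top.ne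
  rw [← ENNReal.ofReal_toReal hpos, ← ENNReal.ofReal_toReal hneg,
    ← ENNReal.ofReal_add h0 ENNReal.toReal_nonneg,
    integral_eq_lintegral_pos_part_sub_lintegral_neg_part hf, sub_add_cancel]

namespace IsPC

variable {k ℓ : ℝ → ℝ} (h : IsPC k ℓ)

include h

lemma aemeasurable_l : AEMeasurable ℓ (volume.restrict (Ioi 0)) :=
  aemeasurable_Ioi_of_forall_Ioc fun T hT => (h.locallyIntegrable_l T hT).aemeasurable

/-- `k * ℓ = 1`, split along the positive and negative parts of `ℓ`. -/
lemma densityMeasure_conv :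
    (densityMeasure k).conv (densityMeasure ℓ) =
      lebesgue + (densityMeasure k).conv (densityMeasure fun t => -ℓ t) := by
  have hone : ∀ᵐ t : ℝ≥0 ∂lebesgue, timeConv k ℓ t = 1 :=
    ae_of_ae_map measurable_coe_nnreal_real.aemeasurable (map_coe_lebesgue ▸ h.conv_eq_one)
  rw [h.isMemoryKernel.densityMeasure_conv h.aemeasurable_l,
    h.isMemoryKernel.densityMeasure_conv (m := fun t => -ℓ t) h.aemeasurable_l.neg]
  nth_rewrite 2 [← withDensity_one (μ := lebesgue)]
  rw [← withDensity_add_left measurable_one]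
  refine withDensity_congr_ae (hone.mono fun t ht => ?_)
  rw [timeConv_eq_setIntegral_Ioo _ _ t.coe_nonneg] at ht
  have hint : IntegrableOn (fun s => k (t - s) * ℓ s) (Ioo 0 t) :=
    Integrable.of_integral_ne_zero (ht.trans_ne one_ne_zero)
  have heq := lintegral_ofReal_eq_ofReal_integral_add hint (ht.symm ▸ zero_le_one)
  simpa only [ht, ENNReal.ofReal_one, ← mul_neg, Pi.add_apply, Pi.one_apply] using heq

lemma laplace_pos {p : ℝ} (hp : 0 < p) : 0 < laplace k p := by
  refine (h.isMemoryKernel.laplace_nonneg p).lt_of_ne fun h0 => ?_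
  have heq := congrArg (measureLaplace · p) h.densityMeasure_conv
  simp only [measureLaplace_add, measureLaplace_conv, ← h0, measureLaplace_lebesgue hp,
    h.isMemoryKernel.measureLaplace_densityMeasure hp, ENNReal.ofReal_zero, zero_mul, add_zero,
    eq_comm (a := (0 : ℝ≥0∞)), ENNReal.ofReal_eq_zero] at heq
  exact (inv_pos.2 hp).not_ge heq

variable {μ : ℝ≥0 → Measure ℝ≥0} (hμ : IsSubordinator (fun p => p * laplace k p) μ)

include hμ

lemma measureLaplace_potential {p : ℝ} (hp : 0 < p) :
    measureLaplace (potential μ) p = ENNReal.ofReal (p * laplace k p)⁻¹ :=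
  hμ.measureLaplace_potential hp (mul_pos hp (h.laplace_pos hp))

lemma sigmaFinite_potential : SigmaFinite (potential μ) :=
  hμ.sigmaFinite_potential one_pos (mul_pos one_pos (h.laplace_pos one_pos))

lemma potential_Iio_ne_top (t : ℝ≥0) : potential μ (Iio t) ≠ ⊤ :=
  measure_Iio_ne_top_of_measureLaplace_ne_top zero_le_one
    ((h.measureLaplace_potential hμ one_pos).trans_ne ENNReal.ofReal_ne_top) t

lemma densityMeasure_conv_potential : (densityMeasure k).conv (potential μ) = lebesgue := by
  have := h.sigmaFinite_potential hμ
  refine (ext_of_measureLaplace (fun p hp => ?_) fun p hp => ?_).symm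
  · exact (measureLaplace_lebesgue hp).trans_ne ENNReal.ofReal_ne_top
  · have hk := h.laplace_pos hp
    rw [measureLaplace_conv, h.isMemoryKernel.measureLaplace_densityMeasure hp,
      h.measureLaplace_potential hμ hp, measureLaplace_lebesgue hp, ← ENNReal.ofReal_mul hk.le]
    congr 1
    field_simp

lemma potential_Iio_pos {t : ℝ≥0} (ht : 0 < t) : 0 < potential μ (Iio t) := by
  have := h.sigmaFinite_potential hμ
  have hle := conv_Iio_le_mul (densityMeasure k) (potential μ) t
  rw [h.densityMeasure_conv_potential hμ, lebesgue_Iio] at hle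
  refine pos_iff_ne_zero.2 fun h0 => ?_
  rw [h0, mul_zero, nonpos_iff_eq_zero, ENNReal.coe_eq_zero] at hle
  exact ht.ne' hle

/-- Convolve `k * ℓ = 1` with the potential measure and cancel `k`. -/
lemma lebesgue_conv_densityMeasure :
    lebesgue.conv (densityMeasure ℓ) =
      lebesgue.conv (potential μ) + lebesgue.conv (densityMeasure fun t => -ℓ t) := by
  have := h.sigmaFinite_potential hμ
  have hcancel : ∀ m : ℝ → ℝ, ((densityMeasure k).conv (densityMeasure m)).conv (potential μ) =
      lebesgue.conv (densityMeasure m) := fun m => by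
    rw [Measure.conv_assoc, Measure.conv_comm (densityMeasure m), ← Measure.conv_assoc,
      h.densityMeasure_conv_potential hμ]
  rw [← hcancel, h.densityMeasure_conv, Measure.add_conv, hcancel]

lemma densityMeasure_Iio {t : ℝ≥0} (ht : 0 < t) :
    densityMeasure ℓ (Iio t) = potential μ (Iio t) + densityMeasure (fun t => -ℓ t) (Iio t) := by
  have := h.sigmaFinite_potential hμ
  have hmeas := fun ν : Measure ℝ≥0 => (monotone_measure_Iio ν).measurable
  have hconv := h.lebesgue_conv_densityMeasure hμ
  rw [lebesgue_conv, lebesgue_conv, lebesgue_conv, ← withDensity_add_left (hmeas _),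
    withDensity_eq_iff_of_sigmaFinite (hmeas _).aemeasurable
      ((hmeas _).add (hmeas _)).aemeasurable] at hconv
  exact eq_of_ae_eq_of_tendsto_nhdsLT hconv ht (tendsto_measure_Iio_nhdsLT _ ht)
    ((tendsto_measure_Iio_nhdsLT _ ht).add (tendsto_measure_Iio_nhdsLT _ ht))

theorem timeConv_one_eq {t : ℝ≥0} (ht : 0 < t) :
    timeConv (fun _ => 1) ℓ t = (potential μ (Iio t)).toReal := by
  have hint : IntegrableOn ℓ (Ioo 0 t) :=
    (h.locallyIntegrable_l t (NNReal.coe_pos.2 ht)).mono_set Ioo_subset_Ioc_self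
  have hIio : ∀ m : ℝ → ℝ, densityMeasure m (Iio t) = ∫⁻ s in Ioo (0 : ℝ) t, ENNReal.ofReal (m s) :=
    fun m => by
      rw [densityMeasure, withDensity_apply _ measurableSet_Iio,
        setLIntegral_Iio_lebesgue fun s => ENNReal.ofReal (m s)]
  have hneg : densityMeasure (fun t => -ℓ t) (Iio t) ≠ ⊤ :=
    (hIio _).trans_ne hint.neg.lintegral_lt_top.ne
  rw [timeConv_eq_setIntegral_Ioo _ _ t.coe_nonneg]
  simp only [one_mul]
  rw [integral_eq_lintegral_pos_part_sub_lintegral_neg_part hint, ← hIio, ← hIio,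
    h.densityMeasure_Iio hμ ht, ENNReal.toReal_add (h.potential_Iio_ne_top hμ t) hneg,
    add_sub_cancel_right]

end IsPC

/-! ### The relaxation estimate -/

section Relaxation

variable {W : ℝ≥0 → ℝ≥0∞}

/-- The tail `∫_b^∞ W` is at most `W(b) ∫ W`; integrate this against `q e^{-qb} db`. -/
lemma lintegral_le_of_submultiplicative (hm : Measurable W) (hsub : ∀ a b, W (a + b) ≤ W a * W b)
    {q : ℝ} (hq : 0 < q) :
    ∫⁻ t, W t ∂lebesgue ≤ measureLaplace (lebesgue.withDensity W) q +
      ENNReal.ofReal q * measureLaplace (lebesgue.withDensity W) q * ∫⁻ t, W t ∂lebesgue := by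
  set V := lebesgue.withDensity W with hV
  set L := ∫⁻ t, W t ∂lebesgue with hL
  have hsplit : ∀ b, L ≤ V (Iio b) + W b * L := fun b => by
    have htail : ∫⁻ t in Ioi b, W t ∂lebesgue ≤ W b * L := by
      rw [← lintegral_lebesgue_add_right, hL, ← lintegral_const_mul _ hm]
      exact lintegral_mono fun t => add_comm b t ▸ hsub b t
    calc L = ∫⁻ t in Ioi b, W t ∂lebesgue + V (Iio b) := by
          rw [hV, withDensity_apply _ measurableSet_Iio, setLIntegral_congr Iio_ae_eq_Iic,
            ← compl_Ioi, lintegral_add_compl W measurableSet_Ioi]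
      _ ≤ V (Iio b) + W b * L := by rw [add_comm]; gcongr
  have hVm : Measurable fun b => V (Iio b) := (monotone_measure_Iio V).measurable
  calc L = ENNReal.ofReal q * ∫⁻ b : ℝ≥0, ENNReal.ofReal (Real.exp (-(q * b))) * L ∂lebesgue := by
        rw [lintegral_mul_const _ (by fun_prop), ← mul_assoc, ← measureLaplace,
          ofReal_mul_measureLaplace_lebesgue hq, one_mul]
    _ ≤ ENNReal.ofReal q * ∫⁻ b : ℝ≥0, (ENNReal.ofReal (Real.exp (-(q * b))) * V (Iio b) +
          ENNReal.ofReal (Real.exp (-(q * b))) * W b * L) ∂lebesgue := by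
        gcongr with b
        rw [mul_assoc, ← mul_add]
        gcongr
        exact hsplit b
    _ = measureLaplace V q + ENNReal.ofReal q * measureLaplace V q * L := by
        rw [lintegral_add_left (by exact Measurable.mul (by fun_prop) hVm),
          lintegral_mul_const _ (by fun_prop), mul_add,
          ← measureLaplace_eq_mul_lintegral_Iio V hq,
          ← measureLaplace_withDensity _ hm.aemeasurable, mul_assoc]

lemma measureLaplace_add_mul_le_one {ν : Measure ℝ≥0} [SFinite ν] (hm : Measurable W)
    (hνW : ∀ b, ν (Iio b) + W b ≤ 1) {q : ℝ} (hq : 0 < q) :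
    measureLaplace ν q + ENNReal.ofReal q * measureLaplace (lebesgue.withDensity W) q ≤ 1 := by
  have hνm : Measurable fun b => ν (Iio b) := (monotone_measure_Iio ν).measurable
  calc measureLaplace ν q + ENNReal.ofReal q * measureLaplace (lebesgue.withDensity W) q
      = ENNReal.ofReal q * ∫⁻ b : ℝ≥0, ENNReal.ofReal (Real.exp (-(q * b))) *
          (ν (Iio b) + W b) ∂lebesgue := by
        simp only [mul_add]
        rw [measureLaplace_eq_mul_lintegral_Iio ν hq,
          measureLaplace_withDensity _ hm.aemeasurable,
          lintegral_add_left (by exact Measurable.mul (by fun_prop) hνm), mul_add]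
    _ ≤ ENNReal.ofReal q * measureLaplace lebesgue q := by
        gcongr
        exact lintegral_mono fun b => mul_le_of_le_one_right' (hνW b)
    _ = 1 := ofReal_mul_measureLaplace_lebesgue hq

/-- With `A` the Laplace transform of `W` at `q` and `L = ∫ W`, the two previous lemmas read
`L ≤ A + q A L` and `ν̂(q) + q A ≤ 1`; now eliminate `A`. -/
theorem measureLaplace_mul_one_add_le_one {ν : Measure ℝ≥0} [SFinite ν] (hm : Measurable W)
    (hsub : ∀ a b, W (a + b) ≤ W a * W b) (hνW : ∀ b, ν (Iio b) + W b ≤ 1)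
    (hfin : ∫⁻ t, W t ∂lebesgue ≠ ⊤) {q : ℝ} (hq : 0 < q) :
    measureLaplace ν q * (1 + ENNReal.ofReal q * ∫⁻ t, W t ∂lebesgue) ≤ 1 := by
  have hL := mul_le_mul_right (lintegral_le_of_submultiplicative hm hsub hq) (ENNReal.ofReal q)
  have hνA := measureLaplace_add_mul_le_one hm hνW hq
  set A := measureLaplace (lebesgue.withDensity W) q
  set L := ∫⁻ t, W t ∂lebesgue
  refine ENNReal.le_of_add_le_add_right (ENNReal.mul_ne_top ENNReal.ofReal_ne_top hfin :
    ENNReal.ofReal q * L ≠ ⊤) ?_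
  calc measureLaplace ν q * (1 + ENNReal.ofReal q * L) + ENNReal.ofReal q * L
      ≤ measureLaplace ν q * (1 + ENNReal.ofReal q * L) +
          ENNReal.ofReal q * (A + ENNReal.ofReal q * A * L) := by gcongr
    _ = (measureLaplace ν q + ENNReal.ofReal q * A) * (1 + ENNReal.ofReal q * L) := by ring
    _ ≤ 1 + ENNReal.ofReal q * L := mul_le_of_le_one_left' hνA

end Relaxation

lemma stieltjesFunction_measure_Ioo_le {g : ℝ → ℝ} (hg : Monotone g) (a b : ℝ) :
    hg.stieltjesFunction.measure (Ioo a b) ≤ ENNReal.ofReal (g b - g a) := by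
  rw [StieltjesFunction.measure_Ioo]
  refine ENNReal.ofReal_le_ofReal (sub_le_sub ?_ ?_)
  · refine le_of_tendsto (hg.stieltjesFunction.mono.tendsto_leftLim b) ?_
    filter_upwards [self_mem_nhdsWithin] with s hs
    exact (hg.stieltjesFunction_eq s).trans_le (hg.rightLim_le hs)
  · exact (hg.le_rightLim le_rfl).trans_eq (hg.stieltjesFunction_eq a).symm

lemma isFiniteMeasure_stieltjesFunction {g : ℝ → ℝ} (hg : Monotone g) {C : ℝ}
    (hC : ∀ τ, |g τ| ≤ C) : IsFiniteMeasure hg.stieltjesFunction.measure :=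
  hg.stieltjesFunction.isFiniteMeasure_of_forall_abs_le (C := C) fun τ => by
    rw [hg.stieltjesFunction_eq]
    exact abs_le.2 ⟨(neg_le_of_abs_le (hC τ)).trans (hg.le_rightLim le_rfl),
      (hg.rightLim_le (lt_add_one τ)).trans (le_of_abs_le (hC _))⟩

namespace IsSubordinator

variable {k : ℝ → ℝ} {μ : ℝ≥0 → Measure ℝ≥0} (h : IsSubordinator (fun p => p * laplace k p) μ)

include h

lemma neg_propagation_eq (t : ℝ≥0) (τ : ℝ) :
    -propagation k t (max τ 0) = -(μ τ.toNNReal (Iio t)).toReal := by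
  rw [← h.propagation_eq, Real.coe_toNNReal']

lemma monotone_neg_propagation (t : ℝ≥0) : Monotone fun τ : ℝ => -propagation k t (max τ 0) :=
  fun a b hab => by
    simp only [h.neg_propagation_eq]
    exact neg_le_neg (ENNReal.toReal_mono (h.Iio_ne_top _ t)
      (h.antitone_Iio t (Real.toNNReal_mono hab)))

lemma propagationMeasure_eq (t : ℝ≥0) :
    propagationMeasure k t = (h.monotone_neg_propagation t).stieltjesFunction.measure :=
  dif_pos (h.monotone_neg_propagation t)

lemma isFiniteMeasure_propagationMeasure (t : ℝ≥0) : IsFiniteMeasure (propagationMeasure k t) := by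
  rw [h.propagationMeasure_eq t]
  refine isFiniteMeasure_stieltjesFunction (C := 1) _ fun τ => ?_
  rw [h.neg_propagation_eq, abs_neg, abs_of_nonneg ENNReal.toReal_nonneg]
  exact ENNReal.toReal_le_of_le_ofReal zero_le_one (by simpa using h.Iio_le_one _ t)

lemma propagationMeasure_Ioo_add_le_one (t b : ℝ≥0) :
    propagationMeasure k t (Ioo 0 b) + μ b (Iio t) ≤ 1 := by
  have hle := stieltjesFunction_measure_Ioo_le (h.monotone_neg_propagation t) 0 b
  rw [← h.propagationMeasure_eq t, h.neg_propagation_eq, h.neg_propagation_eq, Real.toNNReal_coe,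
    neg_sub_neg, ENNReal.ofReal_sub _ ENNReal.toReal_nonneg,
    ENNReal.ofReal_toReal (h.Iio_ne_top _ t), ENNReal.ofReal_toReal (h.Iio_ne_top _ t)] at hle
  calc propagationMeasure k t (Ioo 0 b) + μ b (Iio t)
      ≤ μ (Real.toNNReal 0) (Iio t) - μ b (Iio t) + μ b (Iio t) := by gcongr
    _ = μ (Real.toNNReal 0) (Iio t) :=
        tsub_add_cancel_of_le (h.antitone_Iio t (Real.toNNReal_zero.trans_le zero_le))
    _ ≤ 1 := h.Iio_le_one _ t

end IsSubordinator

lemma IsMemoryKernel.isFiniteMeasure_propagationMeasure {k : ℝ → ℝ} (hk : IsMemoryKernel k)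
    {t : ℝ} (ht : 0 ≤ t) : IsFiniteMeasure (propagationMeasure k t) := by
  lift t to ℝ≥0 using ht
  obtain ⟨μ, h⟩ := hk.exists_isSubordinator
  exact h.isFiniteMeasure_propagationMeasure t

namespace IsPC

variable {k ℓ : ℝ → ℝ} (h : IsPC k ℓ)

include h

theorem timeConv_one_pos {t : ℝ} (ht : 0 < t) : 0 < timeConv (fun _ => 1) ℓ t := by
  lift t to ℝ≥0 using ht.le
  rw [NNReal.coe_pos] at ht
  obtain ⟨μ, hμ⟩ := h.isMemoryKernel.exists_isSubordinator
  rw [h.timeConv_one_eq hμ ht]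
  exact ENNReal.toReal_pos (h.potential_Iio_pos hμ ht).ne' (h.potential_Iio_ne_top hμ t)

theorem lintegral_exp_propagationMeasure_le {t : ℝ} (ht : 0 < t) {q : ℝ} (hq : 0 < q) :
    ∫⁻ τ in Ioi (0 : ℝ), ENNReal.ofReal (Real.exp (-(q * τ))) ∂(propagationMeasure k t) ≤
      ENNReal.ofReal (1 / (1 + q * timeConv (fun _ => 1) ℓ t)) := by
  obtain ⟨μ, hμ⟩ := h.isMemoryKernel.exists_isSubordinator
  have hT := h.timeConv_one_pos ht
  have := h.isMemoryKernel.isFiniteMeasure_propagationMeasure ht.le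
  lift t to ℝ≥0 using ht.le
  rw [NNReal.coe_pos] at ht
  have hL := h.potential_Iio_ne_top hμ t
  let ν : Measure ℝ≥0 := ((propagationMeasure k t).restrict (Ioi 0)).map Real.toNNReal
  have hνW : ∀ b, ν (Iio b) + μ b (Iio t) ≤ 1 := fun b => by
    have hpre : Real.toNNReal ⁻¹' Iio b ∩ Ioi 0 = Ioo 0 (b : ℝ) := by
      ext τ
      exact and_comm.trans (and_congr_right fun hτ => Real.toNNReal_lt_iff_lt_coe (le_of_lt hτ))
    rw [Measure.map_apply measurable_real_toNNReal measurableSet_Iio,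
      Measure.restrict_apply (measurable_real_toNNReal measurableSet_Iio), hpre]
    exact hμ.propagationMeasure_Ioo_add_le_one t b
  have hν : ∫⁻ τ in Ioi (0 : ℝ), ENNReal.ofReal (Real.exp (-(q * τ))) ∂(propagationMeasure k t) =
      measureLaplace ν q := by
    rw [measureLaplace, lintegral_map (by fun_prop) measurable_real_toNNReal]
    refine setLIntegral_congr_fun measurableSet_Ioi fun τ hτ => ?_
    rw [Real.coe_toNNReal _ (le_of_lt hτ)]
  have hmul := measureLaplace_mul_one_add_le_one (hμ.antitone_Iio t).measurable
    (fun a b => hμ.Iio_add_le_mul a b t) hνW (hμ.potential_Iio t ▸ hL) hq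
  rw [← hμ.potential_Iio, ← ENNReal.ofReal_toReal hL, ← h.timeConv_one_eq hμ ht] at hmul
  rw [hν, one_div, ENNReal.ofReal_inv_of_pos (by positivity), ENNReal.le_inv_iff_mul_le,
    ENNReal.ofReal_add zero_le_one (by positivity), ENNReal.ofReal_one, ENNReal.ofReal_mul hq.le]
  exact hmul

end IsPC

/-! ### Plancherel's theorem on `L₁ ∩ L₂` -/

section Plancherel

variable {E F : Type*} [NormedAddCommGroup E] [InnerProductSpace ℝ E] [FiniteDimensional ℝ E]
  [MeasurableSpace E] [BorelSpace E] [NormedAddCommGroup F] [InnerProductSpace ℂ F]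

lemma continuous_fourier_of_integrable {f : E → F} (hf : Integrable f) : Continuous (𝓕 f) :=
  VectorFourier.fourierIntegral_continuous Real.continuous_fourierChar continuous_inner hf

lemma norm_fourier_le_integral_norm (f : E → F) (ξ : E) : ‖𝓕 f ξ‖ ≤ ∫ x, ‖f x‖ :=
  VectorFourier.norm_fourierIntegral_le_integral_norm _ _ _ _ _

variable [CompleteSpace F]

lemma integral_fourier_smul_eq {φ : E → ℂ} {f : E → F} (hφ : Integrable φ) (hf : Integrable f) :
    ∫ ξ, 𝓕 φ ξ • f ξ = ∫ x, φ x • 𝓕 f x := by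
  simpa only [flip_innerₗ] using! VectorFourier.integral_fourierIntegral_smul_eq_flip
    (L := innerₗ E) Real.continuous_fourierChar continuous_inner hφ hf

lemma ae_eq_of_integral_schwartz_smul_eq {f g : E → F} (hf : LocallyIntegrable f)
    (hg : LocallyIntegrable g) (h : ∀ φ : 𝓢(E, ℂ), ∫ x, φ x • f x = ∫ x, φ x • g x) :
    f =ᵐ[volume] g := by
  refine ae_eq_of_integral_contDiff_smul_eq hf hg fun φ hφ hsupp => ?_
  have hsupp' : HasCompactSupport (fun x => (φ x : ℂ)) := hsupp.comp_left Complex.ofReal_zero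
  have hφ' : ContDiff ℝ (⊤ : ℕ∞) (fun x => (φ x : ℂ)) := Complex.ofRealCLM.contDiff.comp hφ
  simpa only [HasCompactSupport.toSchwartzMap_toFun, Complex.coe_smul] using
    h (hsupp'.toSchwartzMap hφ')

lemma fourier_toLp_ae_eq {f : E → F} (h1 : Integrable f) (h2 : MemLp f 2 volume) :
    (𝓕 (h2.toLp f) : Lp F 2 (volume : Measure E)) =ᵐ[volume] 𝓕 f := by
  refine ae_eq_of_integral_schwartz_smul_eq ((Lp.memLp _).locallyIntegrable one_le_two)
    (continuous_fourier_of_integrable h1).locallyIntegrable fun φ => ?_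
  calc ∫ x, φ x • (𝓕 (h2.toLp f) : Lp F 2 (volume : Measure E)) x
      = (𝓕 (Lp.toTemperedDistribution (h2.toLp f))) φ := by
        rw [Lp.fourier_toTemperedDistribution_eq, Lp.toTemperedDistribution_apply]
    _ = ∫ x, 𝓕 (φ : E → ℂ) x • f x := by
        rw [TemperedDistribution.fourier_apply, Lp.toTemperedDistribution_apply,
          ← SchwartzMap.fourier_coe]
        exact integral_congr_ae (h2.coeFn_toLp.mono fun x hx => congrArg _ hx)
    _ = ∫ x, φ x • 𝓕 f x := integral_fourier_smul_eq φ.integrable h1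

theorem memLp_fourier {f : E → F} (h1 : Integrable f) (h2 : MemLp f 2 volume) :
    MemLp (𝓕 f) 2 volume :=
  (memLp_congr_ae (fourier_toLp_ae_eq h1 h2)).1 (Lp.memLp _)

theorem eLpNorm_fourier {f : E → F} (h1 : Integrable f) (h2 : MemLp f 2 volume) :
    eLpNorm (𝓕 f) 2 volume = eLpNorm f 2 volume := by
  rw [← eLpNorm_congr_ae (fourier_toLp_ae_eq h1 h2), ← eLpNorm_congr_ae h2.coeFn_toLp,
    ← Lp.enorm_def, ← Lp.enorm_def, ← ofReal_norm, ← ofReal_norm, Lp.norm_fourier_eq]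

theorem memLp_of_memLp_fourier {f : E → F} (h1 : Integrable f) (h2 : MemLp (𝓕 f) 2 volume) :
    MemLp f 2 volume := by
  let G : Lp F 2 (volume : Measure E) := h2.toLp (𝓕 f)
  refine (memLp_congr_ae ?_).1 (Lp.memLp (𝓕⁻ G))
  refine ae_eq_of_integral_schwartz_smul_eq ((Lp.memLp _).locallyIntegrable one_le_two)
    h1.locallyIntegrable fun φ => ?_
  calc ∫ x, φ x • (𝓕⁻ G) x = (𝓕⁻ (Lp.toTemperedDistribution G)) φ := by
        rw [Lp.fourierInv_toTemperedDistribution_eq, Lp.toTemperedDistribution_apply]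
    _ = ∫ x, (𝓕⁻ φ : 𝓢(E, ℂ)) x • 𝓕 f x := by
        rw [TemperedDistribution.fourierInv_apply, Lp.toTemperedDistribution_apply]
        exact integral_congr_ae (h2.coeFn_toLp.mono fun x hx => congrArg _ hx)
    _ = ∫ x, 𝓕 ((𝓕⁻ φ : 𝓢(E, ℂ)) : E → ℂ) x • f x :=
        (integral_fourier_smul_eq (𝓕⁻ φ).integrable h1).symm
    _ = ∫ x, φ x • f x := by
        rw [← SchwartzMap.fourier_coe, FourierTransform.fourier_fourierInv_eq]

end Plancherel

/-! ### Stable semigroups -/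

section Scaling

variable {E F : Type*} [NormedAddCommGroup E] [NormedSpace ℝ E] [FiniteDimensional ℝ E]
  [MeasurableSpace E] [BorelSpace E] [NormedAddCommGroup F]

lemma eLpNorm_comp_smul (μ : Measure E) [μ.IsAddHaarMeasure] (f : E → F) {c : ℝ} (hc : 0 < c)
    {p : ℝ≥0∞} (hp : p ≠ ⊤) :
    eLpNorm (fun x => f (c • x)) p μ =
      ENNReal.ofReal (c ^ (-(Module.finrank ℝ E / p.toReal))) * eLpNorm f p μ := by
  have h := (measurableEmbedding_const_smul₀ hc.ne').eLpNorm_map_measure (g := f) (p := p) (μ := μ)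
  rw [Measure.map_addHaar_smul _ hc.ne', eLpNorm_smul_measure_of_ne_top hp, smul_eq_mul] at h
  refine h.symm.trans ?_
  rw [abs_of_pos (by positivity), ENNReal.ofReal_rpow_of_pos (by positivity), ← Real.rpow_natCast,
    ← Real.rpow_neg hc.le, ← Real.rpow_mul hc.le, one_div, ENNReal.toReal_inv]
  simp only [neg_mul, div_eq_mul_inv]

end Scaling

section FourierIntegral

variable {E F S : Type*} [NormedAddCommGroup E] [InnerProductSpace ℝ E] [FiniteDimensional ℝ E]
  [MeasurableSpace E] [BorelSpace E] [NormedAddCommGroup F] [NormedSpace ℂ F]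
  [MeasurableSpace S] {σ : Measure S}

lemma fourierInv_comp_smul (f : E → F) {c : ℝ} (hc : 0 < c) (x : E) :
    𝓕⁻ (fun ξ => f (c • ξ)) x = (c ^ Module.finrank ℝ E)⁻¹ • 𝓕⁻ f (c⁻¹ • x) := by
  rw [Real.fourierInv_eq, Real.fourierInv_eq, ← abs_of_pos (inv_pos.2 (pow_pos hc _)),
    ← Measure.integral_comp_smul]
  simp only [real_inner_smul_left, real_inner_smul_right, inv_mul_cancel_left₀ hc.ne']

lemma eLpNorm_one_fourierInv_comp_smul (f : E → F) {c : ℝ} (hc : 0 < c) :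
    eLpNorm (𝓕⁻ fun ξ => f (c • ξ)) 1 volume = eLpNorm (𝓕⁻ f) 1 volume := by
  have h : 𝓕⁻ (fun ξ => f (c • ξ)) =
      (c ^ Module.finrank ℝ E)⁻¹ • fun x => 𝓕⁻ f (c⁻¹ • x) :=
    funext (fourierInv_comp_smul f hc)
  rw [h, eLpNorm_const_smul, eLpNorm_comp_smul _ _ (inv_pos.2 hc) ENNReal.one_ne_top,
    ← mul_assoc, Real.enorm_eq_ofReal (by positivity), ← ENNReal.ofReal_mul (by positivity),
    ENNReal.toReal_one, div_one, Real.inv_rpow hc.le, Real.rpow_neg hc.le, inv_inv,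
    Real.rpow_natCast, inv_mul_cancel₀ (by positivity), ENNReal.ofReal_one, one_mul]

lemma stronglyMeasurable_fourierInv_uncurry {f : E → S → F}
    (hf : StronglyMeasurable (Function.uncurry f)) :
    StronglyMeasurable fun z : E × S => 𝓕⁻ (fun ξ => f ξ z.2) z.1 := by
  simp only [Real.fourierInv_eq]
  have hchar : Continuous fun v : E × E => Real.fourierChar (inner ℝ v.1 v.2) := by fun_prop
  exact ((hchar.stronglyMeasurable.comp_measurable
    (measurable_snd.prodMk (measurable_fst.comp measurable_fst))).smul (hf.comp_measurable
    (measurable_snd.prodMk (measurable_snd.comp measurable_fst)))).integral_prod_right'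

lemma integrable_fourierChar_smul_uncurry {f : E → S → F}
    (hf : Integrable (Function.uncurry f) (volume.prod σ)) (ξ : E) :
    Integrable (Function.uncurry fun x s => Real.fourierChar (-inner ℝ x ξ) • f x s)
      (volume.prod σ) := by
  have hchar : Continuous fun x : E => Real.fourierChar (-inner ℝ x ξ) := by fun_prop
  exact hf.mono ((hchar.stronglyMeasurable.comp_measurable
    measurable_fst).aestronglyMeasurable.smul hf.1) (ae_of_all _ fun z => (Circle.norm_smul _ _).le)

variable [SFinite σ]

lemma fourier_integral_eq_integral_fourier {f : E → S → F}
    (hf : Integrable (Function.uncurry f) (volume.prod σ)) (ξ : E) :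
    𝓕 (fun x => ∫ s, f x s ∂σ) ξ = ∫ s, 𝓕 (fun x => f x s) ξ ∂σ := by
  simp only [Real.fourier_eq]
  rw [← integral_integral_swap (integrable_fourierChar_smul_uncurry hf ξ)]
  exact integral_congr_ae (ae_of_all _ fun x => (integral_smul _ _).symm)

theorem eLpNorm_one_fourierInv_integral_le {f : E → S → F}
    (hf : StronglyMeasurable (Function.uncurry f))
    (hi : Integrable (Function.uncurry f) (volume.prod σ)) :
    eLpNorm (𝓕⁻ fun ξ => ∫ s, f ξ s ∂σ) 1 volume ≤
      ∫⁻ s, eLpNorm (𝓕⁻ fun ξ => f ξ s) 1 volume ∂σ := by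
  simp only [eLpNorm_one_eq_lintegral_enorm]
  rw [← lintegral_lintegral_swap (stronglyMeasurable_fourierInv_uncurry hf).enorm.aemeasurable]
  refine lintegral_mono fun x => ?_
  simp only [Real.fourierInv_eq_fourier_neg]
  rw [fourier_integral_eq_integral_fourier hi]
  exact enorm_integral_le_lintegral_enorm _

end FourierIntegral

section OneSidedStable

variable {α : ℝ}

lemma isMemoryKernel_rpow_neg (h0 : 0 < α) (h1 : α < 1) :
    IsMemoryKernel fun t => t ^ (-α) / Real.Gamma (1 - α) := by
  have : 0 < Real.Gamma (1 - α) := Real.Gamma_pos_of_pos (by linarith)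
  refine ⟨?_, fun t ht => by positivity, fun s hs t _ hst => ?_⟩
  · exact (intervalIntegrable_iff_integrableOn_Ioc_of_le zero_le_one).1
      ((intervalIntegral.intervalIntegrable_rpow' (by linarith)).div_const _)
  · gcongr ?_ / _
    exact Real.rpow_le_rpow_of_nonpos hs hst (by linarith)

lemma mul_laplace_rpow_neg (h1 : α < 1) {p : ℝ} (hp : 0 < p) :
    p * laplace (fun t => t ^ (-α) / Real.Gamma (1 - α)) p = p ^ α := by
  have hΓ : 0 < Real.Gamma (1 - α) := Real.Gamma_pos_of_pos (by linarith)
  have h := Real.integral_rpow_mul_exp_neg_mul_Ioi (a := 1 - α) (r := p) (by linarith) hp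
  rw [sub_sub_cancel_left] at h
  have hlap : laplace (fun t => t ^ (-α) / Real.Gamma (1 - α)) p = (1 / p) ^ (1 - α) := by
    rw [laplace, ← mul_div_cancel_right₀ ((1 / p) ^ (1 - α)) hΓ.ne', ← h, ← integral_div]
    simp only [mul_comm (Real.exp _), div_mul_eq_mul_div]
  rw [hlap, one_div, Real.inv_rpow hp.le, ← Real.rpow_neg hp.le, neg_sub,
    Real.rpow_sub_one hp.ne', mul_div_cancel₀ _ hp.ne']

lemma measure_singleton_zero_le_measureLaplace (ν : Measure ℝ≥0) (p : ℝ) :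
    ν {0} ≤ measureLaplace ν p :=
  calc ν {0} = ∫⁻ s in ({0} : Set ℝ≥0), ENNReal.ofReal (Real.exp (-(p * s))) ∂ν := by
        rw [lintegral_singleton]
        simp
    _ ≤ measureLaplace ν p := setLIntegral_le_lintegral _ _

lemma measure_singleton_zero_eq_zero {ν : Measure ℝ≥0}
    (h : Tendsto (measureLaplace ν) atTop (𝓝 0)) : ν {0} = 0 :=
  nonpos_iff_eq_zero.1 (ge_of_tendsto' h (measure_singleton_zero_le_measureLaplace ν))

theorem exists_measureLaplace_eq_exp_neg_rpow (h0 : 0 < α) (h1 : α < 1) :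
    ∃ σ : Measure ℝ≥0, σ univ ≤ 1 ∧ σ {0} = 0 ∧ ∀ p, 0 < p →
      measureLaplace σ p = ENNReal.ofReal (Real.exp (-p ^ α)) := by
  obtain ⟨σ, hσ1, hσ⟩ := (isMemoryKernel_rpow_neg h0 h1).exists_measureLaplace_eq_exp
  have hexp : ∀ p, 0 < p → measureLaplace σ p = ENNReal.ofReal (Real.exp (-p ^ α)) :=
    fun p hp => by rw [hσ p hp, mul_laplace_rpow_neg h1 hp]
  have hlim : Tendsto (fun p : ℝ => ENNReal.ofReal (Real.exp (-p ^ α))) atTop (𝓝 0) := by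
    rw [← ENNReal.ofReal_zero]
    exact ENNReal.tendsto_ofReal (Real.tendsto_exp_neg_atTop_nhds_zero.comp (tendsto_rpow_atTop h0))
  refine ⟨σ, hσ1, measure_singleton_zero_eq_zero (hlim.congr' ?_), hexp⟩
  filter_upwards [eventually_gt_atTop 0] with p hp using (hexp p hp).symm

end OneSidedStable

section ExpSchwartz

variable {E : Type*} [NormedAddCommGroup E] [NormedSpace ℝ E]

lemma norm_iteratedFDeriv_exp_comp_le {f : E → ℝ} (hf : f.HasTemperateGrowth) (n : ℕ) :
    ∃ (a : ℕ) (D : ℝ), 0 ≤ D ∧ ∀ x,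
      ‖iteratedFDeriv ℝ n (fun y => Real.exp (f y)) x‖ ≤ D * (1 + ‖x‖) ^ a * Real.exp (f x) := by
  obtain ⟨a, C, hC, hbound⟩ := hf.norm_iteratedFDeriv_le_uniform n
  have hD : 1 ≤ C + 1 := by linarith
  refine ⟨a * n, n.factorial * (C + 1) ^ n, by positivity, fun x => ?_⟩
  have hexp : ∀ i ≤ n, ‖iteratedFDeriv ℝ i Real.exp (f x)‖ ≤ Real.exp (f x) := fun i _ => by
    rw [norm_iteratedFDeriv_eq_norm_iteratedDeriv, iteratedDeriv_eq_iterate, Real.iter_deriv_exp,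
      Real.norm_eq_abs, Real.abs_exp]
  have hderiv : ∀ i, 1 ≤ i → i ≤ n →
      ‖iteratedFDeriv ℝ i f x‖ ≤ ((C + 1) * (1 + ‖x‖) ^ a) ^ i := fun i hi1 hi =>
    calc ‖iteratedFDeriv ℝ i f x‖ ≤ C * (1 + ‖x‖) ^ a := hbound i hi x
      _ ≤ (C + 1) * (1 + ‖x‖) ^ a := by gcongr; linarith
      _ ≤ ((C + 1) * (1 + ‖x‖) ^ a) ^ i := le_self_pow₀ (one_le_mul_of_one_le_of_one_le hD
          (one_le_pow₀ (by linarith [norm_nonneg x]))) (by omega)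
  refine (norm_iteratedFDeriv_comp_le (Real.contDiff_exp (n := (⊤ : ℕ∞))) hf.1
    (by exact_mod_cast le_top) x hexp hderiv).trans_eq ?_
  rw [mul_pow, ← pow_mul]
  ring

lemma pow_mul_exp_neg_le {r : ℝ} (hr : 0 ≤ r) (m : ℕ) : r ^ m * Real.exp (-r) ≤ m.factorial := by
  rw [Real.exp_neg, ← div_eq_mul_inv, div_le_iff₀ (Real.exp_pos r), ← div_le_iff₀' (by positivity)]
  exact Real.pow_div_factorial_le_exp r hr m

/-- The Schwartz function `exp ∘ f`, for a smooth `f` of temperate growth that tends to `-∞` at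
least linearly. -/
def expSchwartz (f : E → ℝ) (hf : f.HasTemperateGrowth) {C : ℝ} (hC : ∀ x, f x ≤ C - ‖x‖) :
    𝓢(E, ℝ) where
  toFun x := Real.exp (f x)
  smooth' := Real.contDiff_exp.comp hf.1
  decay' k n := by
    obtain ⟨a, D, hD, hbound⟩ := norm_iteratedFDeriv_exp_comp_le hf n
    refine ⟨D * ((k + a).factorial * Real.exp (C + 1)), fun x => ?_⟩
    calc ‖x‖ ^ k * ‖iteratedFDeriv ℝ n (fun y => Real.exp (f y)) x‖
        ≤ (1 + ‖x‖) ^ k * (D * (1 + ‖x‖) ^ a * Real.exp (C - ‖x‖)) := by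
          gcongr
          · linarith
          · exact (hbound x).trans (by gcongr; exact hC x)
      _ = D * ((1 + ‖x‖) ^ (k + a) * Real.exp (-(1 + ‖x‖)) * Real.exp (C + 1)) := by
          rw [mul_assoc ((1 + ‖x‖) ^ (k + a)), ← Real.exp_add, pow_add]
          ring_nf
      _ ≤ D * ((k + a).factorial * Real.exp (C + 1)) := by
          gcongr
          exact pow_mul_exp_neg_le (by positivity) _

lemma expSchwartz_apply {f : E → ℝ} (hf : f.HasTemperateGrowth) {C : ℝ}
    (hC : ∀ x, f x ≤ C - ‖x‖) (x : E) : expSchwartz f hf hC x = Real.exp (f x) := rfl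

end ExpSchwartz

section StableSymbol

/-- The Fourier symbol `ξ ↦ exp(-s ‖ξ‖^ρ)` of the rotation invariant `ρ`-stable semigroup. -/
def stableSymbol (E : Type*) [NormedAddCommGroup E] (ρ s : ℝ) (ξ : E) : ℂ :=
  ((Real.exp (-(s * ‖ξ‖ ^ ρ)) : ℝ) : ℂ)

lemma enorm_stableSymbol {E : Type*} [NormedAddCommGroup E] (ρ s : ℝ) (ξ : E) :
    ‖stableSymbol E ρ s ξ‖ₑ = ENNReal.ofReal (Real.exp (-(s * ‖ξ‖ ^ ρ))) := by
  rw [stableSymbol, ← ofReal_norm, Complex.norm_real, Real.norm_eq_abs, Real.abs_exp]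

lemma continuous_stableSymbol_uncurry {E : Type*} [NormedAddCommGroup E] {ρ : ℝ} (hρ : 0 < ρ) :
    Continuous fun z : E × ℝ => stableSymbol E ρ z.2 z.1 := by
  have hnorm : Continuous fun z : E × ℝ => ‖z.1‖ ^ ρ :=
    (by fun_prop : Continuous fun z : E × ℝ => ‖z.1‖).rpow_const fun _ => Or.inr hρ.le
  unfold stableSymbol
  fun_prop

variable {E : Type*} [NormedAddCommGroup E] [InnerProductSpace ℝ E]

lemma stableSymbol_smul (ρ s : ℝ) {c : ℝ} (hc : 0 ≤ c) (ξ : E) :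
    stableSymbol E ρ s (c • ξ) = stableSymbol E ρ (s * c ^ ρ) ξ := by
  rw [stableSymbol, stableSymbol, norm_smul, Real.norm_of_nonneg hc,
    Real.mul_rpow hc (norm_nonneg ξ), mul_assoc]

lemma exists_schwartzMap_eq_stableSymbol {N : ℕ} (hN : N ≠ 0) :
    ∃ φ : 𝓢(E, ℂ), stableSymbol E (2 * N) 1 = φ := by
  have hdecay : ∀ ξ : E, -(‖ξ‖ ^ 2) ^ N ≤ 1 - ‖ξ‖ := fun ξ => by
    rw [← pow_mul]
    rcases le_total 1 ‖ξ‖ with h | h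
    · linarith [le_self_pow₀ h (by positivity : 2 * N ≠ 0)]
    · linarith [pow_nonneg (norm_nonneg ξ) (2 * N)]
  have hgrowth : (fun ξ : E => -(‖ξ‖ ^ 2) ^ N).HasTemperateGrowth :=
    ((Function.hasTemperateGrowth_norm_sq E).pow N).neg
  refine ⟨(expSchwartz _ hgrowth hdecay).postcompCLM Complex.ofRealCLM, ?_⟩
  ext ξ
  rw [SchwartzMap.postcompCLM_apply, expSchwartz_apply, stableSymbol, one_mul,
      Real.rpow_mul (norm_nonneg ξ), Real.rpow_two, Real.rpow_natCast, Complex.ofRealCLM_apply]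

variable [FiniteDimensional ℝ E] [MeasurableSpace E] [BorelSpace E]

lemma integrable_stableSymbol [Nontrivial E] {ρ s : ℝ} (hρ : 0 < ρ) (hs : 0 < s) :
    Integrable (stableSymbol E ρ s) := by
  refine Integrable.ofReal ((integrable_fun_norm_addHaar volume
    (f := fun r => Real.exp (-(s * r ^ ρ)))).2 ?_)
  have hexponent : (-1 : ℝ) < (Module.finrank ℝ E - 1 : ℕ) :=
    neg_one_lt_zero.trans_le (Nat.cast_nonneg _)
  simpa only [Real.rpow_natCast, neg_mul, smul_eq_mul] using
    integrableOn_rpow_mul_exp_neg_mul_rpow hexponent hρ hs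

lemma eLpNorm_one_fourierInv_stableSymbol {ρ s : ℝ} (hρ : ρ ≠ 0) (hs : 0 < s) :
    eLpNorm (𝓕⁻ (stableSymbol E ρ s)) 1 volume = eLpNorm (𝓕⁻ (stableSymbol E ρ 1)) 1 volume := by
  have h : stableSymbol E ρ s = fun ξ => stableSymbol E ρ 1 (s ^ ρ⁻¹ • ξ) := by
    ext ξ
    rw [stableSymbol_smul _ _ (by positivity), one_mul, Real.rpow_inv_rpow hs.le hρ]
  rw [h, eLpNorm_one_fourierInv_comp_smul _ (by positivity)]

lemma eLpNorm_one_fourierInv_stableSymbol_even_ne_top {N : ℕ} (hN : N ≠ 0) :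
    eLpNorm (𝓕⁻ (stableSymbol E (2 * N) 1)) 1 volume ≠ ⊤ := by
  obtain ⟨φ, hφ⟩ := exists_schwartzMap_eq_stableSymbol (E := E) hN
  have hint : Integrable (𝓕⁻ (φ : E → ℂ)) := by
    rw [← SchwartzMap.fourierInv_coe]
    exact (𝓕⁻ φ).integrable
  exact hφ ▸ (memLp_one_iff_integrable.2 hint).eLpNorm_ne_top

end StableSymbol

section Subordination

variable {E : Type*} [NormedAddCommGroup E] {σ : Measure ℝ≥0} {ρ ρ' : ℝ}

lemma lintegral_enorm_stableSymbol (hρ' : 0 < ρ') (hσ : ∀ p, 0 < p → measureLaplace σ p =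
    ENNReal.ofReal (Real.exp (-p ^ (ρ / ρ')))) {ξ : E} (hξ : ξ ≠ 0) :
    ∫⁻ s : ℝ≥0, ‖stableSymbol E ρ' s ξ‖ₑ ∂σ = ‖stableSymbol E ρ 1 ξ‖ₑ := by
  have hξ' : 0 < ‖ξ‖ := norm_pos_iff.2 hξ
  have h := hσ (‖ξ‖ ^ ρ') (by positivity)
  rw [← Real.rpow_mul hξ'.le, mul_div_cancel₀ _ hρ'.ne'] at h
  simp only [enorm_stableSymbol, one_mul, ← h, measureLaplace, mul_comm (‖ξ‖ ^ ρ')]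

lemma integral_stableSymbol (hρ' : 0 < ρ') (hσ : ∀ p, 0 < p → measureLaplace σ p =
    ENNReal.ofReal (Real.exp (-p ^ (ρ / ρ')))) {ξ : E} (hξ : ξ ≠ 0) :
    ∫ s : ℝ≥0, stableSymbol E ρ' s ξ ∂σ = stableSymbol E ρ 1 ξ := by
  have h := lintegral_enorm_stableSymbol hρ' hσ hξ
  simp only [enorm_stableSymbol] at h
  simp only [stableSymbol]
  rw [integral_complex_ofReal, integral_eq_lintegral_of_nonneg_ae
    (ae_of_all _ fun _ => (Real.exp_pos _).le) (by fun_prop), h,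
    ENNReal.toReal_ofReal (Real.exp_pos _).le]

variable [InnerProductSpace ℝ E] [FiniteDimensional ℝ E] [MeasurableSpace E] [BorelSpace E]
  [Nontrivial E]

lemma integrable_stableSymbol_uncurry [SFinite σ] (hρ : 0 < ρ) (hρ' : 0 < ρ')
    (hσ : ∀ p, 0 < p → measureLaplace σ p = ENNReal.ofReal (Real.exp (-p ^ (ρ / ρ')))) :
    Integrable (Function.uncurry fun (ξ : E) (s : ℝ≥0) => stableSymbol E ρ' s ξ)
      (volume.prod σ) := by
  have hm : StronglyMeasurable (Function.uncurry fun (ξ : E) (s : ℝ≥0) => stableSymbol E ρ' s ξ) :=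
    ((continuous_stableSymbol_uncurry hρ').comp
      (by fun_prop : Continuous fun z : E × ℝ≥0 => (z.1, (z.2 : ℝ)))).stronglyMeasurable
  refine ⟨hm.aestronglyMeasurable, ?_⟩
  rw [HasFiniteIntegral, lintegral_prod _ hm.enorm.aemeasurable]
  refine (lintegral_congr_ae ?_).trans_lt (integrable_stableSymbol (E := E) hρ one_pos).2
  filter_upwards [Measure.ae_ne volume 0] with ξ hξ using lintegral_enorm_stableSymbol hρ' hσ hξ

/-- Bochner subordination: `ξ ↦ exp(-‖ξ‖^ρ)` is a mixture of the symbols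
`ξ ↦ exp(-s ‖ξ‖^ρ')`, `s > 0`. -/
theorem eLpNorm_one_fourierInv_stableSymbol_mono (hρ : 0 < ρ) (hρρ' : ρ < ρ') :
    eLpNorm (𝓕⁻ (stableSymbol E ρ 1)) 1 volume ≤ eLpNorm (𝓕⁻ (stableSymbol E ρ' 1)) 1 volume := by
  have hρ' : 0 < ρ' := hρ.trans hρρ'
  obtain ⟨σ, hσ1, hσ0, hσ⟩ := exists_measureLaplace_eq_exp_neg_rpow (div_pos hρ hρ')
    ((div_lt_one hρ').2 hρρ')
  have : IsFiniteMeasure σ := ⟨hσ1.trans_lt ENNReal.one_lt_top⟩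
  have hm : StronglyMeasurable (Function.uncurry fun (ξ : E) (s : ℝ≥0) => stableSymbol E ρ' s ξ) :=
    ((continuous_stableSymbol_uncurry hρ').comp
      (by fun_prop : Continuous fun z : E × ℝ≥0 => (z.1, (z.2 : ℝ)))).stronglyMeasurable
  have hmix : 𝓕⁻ (stableSymbol E ρ 1) = 𝓕⁻ fun ξ : E => ∫ s : ℝ≥0, stableSymbol E ρ' s ξ ∂σ := by
    ext x
    simp only [Real.fourierInv_eq]
    refine integral_congr_ae ?_
    filter_upwards [Measure.ae_ne volume 0] with ξ hξ
    rw [integral_stableSymbol hρ' hσ hξ]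
  have hpos : ∀ᵐ s ∂σ, s ≠ 0 := measure_eq_zero_iff_ae_notMem.1 hσ0
  calc eLpNorm (𝓕⁻ (stableSymbol E ρ 1)) 1 volume
      ≤ ∫⁻ s : ℝ≥0, eLpNorm (𝓕⁻ (stableSymbol E ρ' s)) 1 volume ∂σ :=
        hmix ▸ eLpNorm_one_fourierInv_integral_le hm (integrable_stableSymbol_uncurry hρ hρ' hσ)
    _ = ∫⁻ _ : ℝ≥0, eLpNorm (𝓕⁻ (stableSymbol E ρ' 1)) 1 volume ∂σ := by
        refine lintegral_congr_ae (hpos.mono fun s hs => ?_)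
        exact eLpNorm_one_fourierInv_stableSymbol hρ'.ne' (NNReal.coe_pos.2 (pos_of_ne_zero hs))
    _ ≤ eLpNorm (𝓕⁻ (stableSymbol E ρ' 1)) 1 volume := by
        rw [lintegral_const]
        exact mul_le_of_le_one_right' hσ1

theorem eLpNorm_one_fourierInv_stableSymbol_ne_top (hρ : 0 < ρ) :
    eLpNorm (𝓕⁻ (stableSymbol E ρ 1)) 1 volume ≠ ⊤ := by
  obtain ⟨N, hN⟩ := exists_nat_gt ρ
  have hN0 : (0 : ℝ) < N := hρ.trans hN
  exact ne_top_of_le_ne_top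
    (eLpNorm_one_fourierInv_stableSymbol_even_ne_top (Nat.cast_pos.1 hN0).ne')
    (eLpNorm_one_fourierInv_stableSymbol_mono hρ (by linarith))

end Subordination

/-! ### The mild solution -/

section StableDensity

variable {d : ℕ} {ρ τ : ℝ}

lemma eta_eq_fourierInv (d : ℕ) (ρ τ : ℝ) :
    eta d ρ τ = 𝓕⁻ (stableSymbol (EuclideanSpace ℝ (Fin d)) ρ (τ * (2 * Real.pi) ^ ρ)) := by
  have hπ : 0 < 2 * Real.pi := Real.two_pi_pos
  ext x
  have hsymbol : stableSymbol (EuclideanSpace ℝ (Fin d)) ρ (τ * (2 * Real.pi) ^ ρ) =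
      fun ξ => stableSymbol _ ρ τ ((2 * Real.pi) • ξ) :=
    funext fun ξ => (stableSymbol_smul ρ τ hπ.le ξ).symm
  rw [hsymbol, fourierInv_comp_smul _ hπ, eta, Real.fourierInv_eq', finrank_euclideanSpace_fin,
    Complex.real_smul, Complex.ofReal_inv]
  simp only [real_inner_smul_right, mul_inv_cancel_left₀ hπ.ne', real_inner_comm x, smul_eq_mul,
    mul_comm Complex.I, stableSymbol]

lemma stronglyMeasurable_eta_uncurry (d : ℕ) (hρ : 0 < ρ) :
    StronglyMeasurable (Function.uncurry fun x τ => eta d ρ τ x) := by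
  have hsymbol : Continuous (Function.uncurry fun (ξ : EuclideanSpace ℝ (Fin d)) (τ : ℝ) =>
      stableSymbol (EuclideanSpace ℝ (Fin d)) ρ (τ * (2 * Real.pi) ^ ρ) ξ) :=
    (continuous_stableSymbol_uncurry hρ).comp (by fun_prop :
      Continuous fun z : EuclideanSpace ℝ (Fin d) × ℝ => (z.1, z.2 * (2 * Real.pi) ^ ρ))
  simpa only [eta_eq_fourierInv] using!
    stronglyMeasurable_fourierInv_uncurry hsymbol.stronglyMeasurable

lemma eLpNorm_one_eta (d : ℕ) (hρ : ρ ≠ 0) (hτ : 0 < τ) :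
    eLpNorm (eta d ρ τ) 1 volume =
      eLpNorm (𝓕⁻ (stableSymbol (EuclideanSpace ℝ (Fin d)) ρ 1)) 1 volume := by
  rw [eta_eq_fourierInv, eLpNorm_one_fourierInv_stableSymbol hρ (by positivity)]

variable [NeZero d]

lemma integrable_eta (hρ : 0 < ρ) (hτ : 0 < τ) : Integrable (eta d ρ τ) := by
  refine memLp_one_iff_integrable.1 ⟨((stronglyMeasurable_eta_uncurry d hρ).comp_measurable
    measurable_prodMk_right).aestronglyMeasurable, ?_⟩
  rw [eLpNorm_one_eta d hρ.ne' hτ]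
  exact (eLpNorm_one_fourierInv_stableSymbol_ne_top hρ).lt_top

theorem fourier_eta (hρ : 0 < ρ) (hτ : 0 < τ) :
    𝓕 (eta d ρ τ) = stableSymbol (EuclideanSpace ℝ (Fin d)) ρ (τ * (2 * Real.pi) ^ ρ) := by
  have hcont : Continuous (stableSymbol (EuclideanSpace ℝ (Fin d)) ρ (τ * (2 * Real.pi) ^ ρ)) :=
    (continuous_stableSymbol_uncurry hρ).comp (Continuous.prodMk_left _)
  have hint := (integrable_eta (d := d) hρ hτ).comp_neg
  rw [eta_eq_fourierInv] at hint ⊢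
  refine hcont.fourier_fourierInv_eq (integrable_stableSymbol hρ (by positivity)) ?_
  simpa only [Real.fourierInv_eq_fourier_neg, neg_neg] using hint

end StableDensity

section FundamentalSolution

variable {d : ℕ} [NeZero d] {ρ t : ℝ} {k ℓ : ℝ → ℝ}

lemma integrable_eta_uncurry (hρ : 0 < ρ) (m : Measure ℝ) [IsFiniteMeasure m] :
    Integrable (Function.uncurry fun x τ => eta d ρ τ x) (volume.prod (m.restrict (Ioi 0))) := by
  have hm := stronglyMeasurable_eta_uncurry d hρ
  refine ⟨hm.aestronglyMeasurable, ?_⟩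
  rw [HasFiniteIntegral, lintegral_prod_symm _ hm.enorm.aemeasurable]
  calc ∫⁻ τ in Ioi (0 : ℝ), (∫⁻ x, ‖eta d ρ τ x‖ₑ) ∂m
      = ∫⁻ _ in Ioi (0 : ℝ),
          eLpNorm (𝓕⁻ (stableSymbol (EuclideanSpace ℝ (Fin d)) ρ 1)) 1 volume ∂m :=
        setLIntegral_congr_fun measurableSet_Ioi fun τ hτ => by
          rw [← eLpNorm_one_eta d hρ.ne' hτ, eLpNorm_one_eq_lintegral_enorm]
    _ < ⊤ := by
        rw [setLIntegral_const]
        exact ENNReal.mul_lt_top (eLpNorm_one_fourierInv_stableSymbol_ne_top hρ).lt_top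
          (measure_lt_top _ _)

lemma integrable_fundamentalSolution [IsFiniteMeasure (propagationMeasure k t)] (hρ : 0 < ρ) :
    Integrable (fundamentalSolution d ρ k t) :=
  (integrable_eta_uncurry hρ _).integral_prod_left

lemma fourier_fundamentalSolution [IsFiniteMeasure (propagationMeasure k t)] (hρ : 0 < ρ)
    (ζ : EuclideanSpace ℝ (Fin d)) :
    𝓕 (fundamentalSolution d ρ k t) ζ =
      ∫ τ in Ioi (0 : ℝ), stableSymbol _ ρ (τ * (2 * Real.pi) ^ ρ) ζ ∂propagationMeasure k t := by
  refine (fourier_integral_eq_integral_fourier (integrable_eta_uncurry hρ _) ζ).trans ?_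
  exact setIntegral_congr_fun measurableSet_Ioi fun τ hτ => congrFun (fourier_eta hρ hτ) ζ

lemma IsPC.norm_fourier_fundamentalSolution_le (h : IsPC k ℓ) (hρ : 0 < ρ) (ht : 0 < t)
    {ζ : EuclideanSpace ℝ (Fin d)} (hζ : ζ ≠ 0) :
    ‖𝓕 (fundamentalSolution d ρ k t) ζ‖ ≤
      1 / (1 + (2 * Real.pi * ‖ζ‖) ^ ρ * timeConv (fun _ => 1) ℓ t) := by
  have := h.isMemoryKernel.isFiniteMeasure_propagationMeasure ht.le
  have hL := h.timeConv_one_pos ht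
  have hq : 0 < (2 * Real.pi * ‖ζ‖) ^ ρ := by
    have := norm_pos_iff.2 hζ
    positivity
  rw [← ENNReal.ofReal_le_ofReal_iff (by positivity), ofReal_norm, fourier_fundamentalSolution hρ]
  refine (enorm_integral_le_lintegral_enorm _).trans
    (le_of_eq_of_le ?_ (h.lintegral_exp_propagationMeasure_le ht hq))
  refine lintegral_congr fun τ => ?_
  rw [enorm_stableSymbol, Real.mul_rpow Real.two_pi_pos.le (norm_nonneg ζ), mul_assoc, mul_comm τ]

end FundamentalSolution

section MildSolution

variable {d : ℕ} {ρ t : ℝ} {k ℓ : ℝ → ℝ} {u₀ : EuclideanSpace ℝ (Fin d) → ℂ}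

lemma mildSolution_eq_convolution :
    mildSolution d ρ k u₀ t = u₀ ⋆[ContinuousLinearMap.mul ℂ ℂ] fundamentalSolution d ρ k t := by
  ext x
  simp only [mildSolution, convolution_def, ContinuousLinearMap.mul_apply', mul_comm]

variable [NeZero d]

lemma ae_integrable_fundamentalSolution_mul [IsFiniteMeasure (propagationMeasure k t)]
    (hρ : 0 < ρ) (hu₁ : Integrable u₀) :
    ∀ᵐ x, Integrable fun y => fundamentalSolution d ρ k t (x - y) * u₀ y := by
  filter_upwards [hu₁.ae_convolution_exists (ContinuousLinearMap.mul ℂ ℂ)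
    (integrable_fundamentalSolution (k := k) (t := t) hρ)] with x hx
  simpa only [ContinuousLinearMap.mul_apply', mul_comm] using hx.integrable

lemma integrable_mildSolution [IsFiniteMeasure (propagationMeasure k t)] (hρ : 0 < ρ)
    (hu₁ : Integrable u₀) : Integrable (mildSolution d ρ k u₀ t) := by
  rw [mildSolution_eq_convolution]
  exact hu₁.integrable_convolution _ (integrable_fundamentalSolution hρ)

lemma fourier_mildSolution [IsFiniteMeasure (propagationMeasure k t)] (hρ : 0 < ρ)
    (hu₁ : Integrable u₀) (ζ : EuclideanSpace ℝ (Fin d)) :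
    𝓕 (mildSolution d ρ k u₀ t) ζ = 𝓕 u₀ ζ * 𝓕 (fundamentalSolution d ρ k t) ζ := by
  rw [mildSolution_eq_convolution]
  exact Real.fourier_mul_convolution_eq hu₁ (integrable_fundamentalSolution hρ) ζ

lemma IsPC.norm_fourier_mildSolution_le (h : IsPC k ℓ) (hρ : 0 < ρ) (ht : 0 < t)
    (hu₁ : Integrable u₀) {ζ : EuclideanSpace ℝ (Fin d)} (hζ : ζ ≠ 0) :
    ‖𝓕 (mildSolution d ρ k u₀ t) ζ‖ ≤
      ‖𝓕 u₀ ζ‖ * (1 / (1 + (2 * Real.pi * ‖ζ‖) ^ ρ * timeConv (fun _ => 1) ℓ t)) := by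
  have := h.isMemoryKernel.isFiniteMeasure_propagationMeasure ht.le
  rw [fourier_mildSolution hρ hu₁, norm_mul]
  gcongr
  exact h.norm_fourier_fundamentalSolution_le hρ ht hζ

lemma IsPC.memLp_fourier_mildSolution (h : IsPC k ℓ) (hρ : 0 < ρ) (ht : 0 < t)
    (hu₁ : Integrable u₀) (hu₂ : MemLp u₀ 2 volume) :
    MemLp (𝓕 (mildSolution d ρ k u₀ t)) 2 volume := by
  have := h.isMemoryKernel.isFiniteMeasure_propagationMeasure ht.le
  have hL := h.timeConv_one_pos ht
  refine (memLp_fourier hu₁ hu₂).mono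
    (continuous_fourier_of_integrable (integrable_mildSolution hρ hu₁)).aestronglyMeasurable ?_
  filter_upwards [Measure.ae_ne volume 0] with ζ hζ
  refine (h.norm_fourier_mildSolution_le hρ ht hu₁ hζ).trans
    (mul_le_of_le_one_right (norm_nonneg _) (div_le_one_of_le₀ ?_ (by positivity)))
  exact le_add_of_nonneg_right (by positivity)

theorem IsPC.memLp_mildSolution (h : IsPC k ℓ) (hρ : 0 < ρ) (ht : 0 < t)
    (hu₁ : Integrable u₀) (hu₂ : MemLp u₀ 2 volume) : MemLp (mildSolution d ρ k u₀ t) 2 volume :=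
  have := h.isMemoryKernel.isFiniteMeasure_propagationMeasure ht.le
  memLp_of_memLp_fourier (integrable_mildSolution hρ hu₁)
    (h.memLp_fourier_mildSolution hρ ht hu₁ hu₂)

end MildSolution

/-! ### Decay in L₂ -/

section RieszWeight

variable {E : Type*} [NormedAddCommGroup E] [NormedSpace ℝ E] [FiniteDimensional ℝ E]
  [MeasurableSpace E] [BorelSpace E] {μ : Measure E} [μ.IsAddHaarMeasure] {p : ℝ≥0∞} {s : ℝ}

lemma memLp_norm_rpow_neg_restrict_ball (hp : p ≠ 0) (hp' : p ≠ ⊤) (hs : 0 ≤ s)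
    (hsp : s * p.toReal < Module.finrank ℝ E) (r : ℝ) :
    MemLp (fun x : E => ‖x‖ ^ (-s)) p (μ.restrict (Metric.ball 0 r)) := by
  have hmeas : Measurable fun x : E => ‖x‖ ^ (-s) := by fun_prop
  have hdim : 1 ≤ Module.finrank ℝ E := by
    exact_mod_cast (mul_nonneg hs ENNReal.toReal_nonneg).trans_lt hsp
  refine (integrable_norm_rpow_iff hmeas.aestronglyMeasurable hp hp').1 ?_
  refine integrableOn_ball_of_norm_le_rpow (C := 1) hdim hsp (ae_of_all _ fun x => ?_)
    (hmeas.norm.pow_const _).aestronglyMeasurable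
  rw [one_mul, ← neg_mul, Real.rpow_mul (norm_nonneg x), Real.norm_of_nonneg (by positivity),
    Real.norm_of_nonneg (by positivity)]

lemma memLp_norm_mul_norm_rpow_neg {F : Type*} [NormedAddCommGroup F] {f : E → F} {M : ℝ}
    (hp : p ≠ 0) (hp' : p ≠ ⊤) (hs : 0 ≤ s) (hsp : s * p.toReal < Module.finrank ℝ E)
    (hf : MemLp f p μ) (hM : ∀ x, ‖f x‖ ≤ M) :
    MemLp (fun x => ‖f x‖ * ‖x‖ ^ (-s)) p μ := by
  classical
  have hmeas : AEStronglyMeasurable (fun x => ‖f x‖ * ‖x‖ ^ (-s)) μ :=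
    hf.1.norm.mul (by fun_prop : Measurable fun x : E => ‖x‖ ^ (-s)).aestronglyMeasurable
  have near_zero : MemLp (fun x => ‖f x‖ * ‖x‖ ^ (-s)) p (μ.restrict (Metric.ball 0 1)) := by
    refine (memLp_norm_rpow_neg_restrict_ball hp hp' hs hsp 1).of_le_mul (c := M) hmeas.restrict
      (ae_of_all _ fun x => ?_)
    rw [norm_mul, norm_norm]
    gcongr
    exact hM x
  have away_from_zero :
      MemLp (fun x => ‖f x‖ * ‖x‖ ^ (-s)) p (μ.restrict (Metric.ball 0 1)ᶜ) := by
    refine (hf.restrict _).mono hmeas.restrict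
      (ae_restrict_of_forall_mem Metric.isOpen_ball.measurableSet.compl fun x hx => ?_)
    have h1 : 1 ≤ ‖x‖ := by simpa using hx
    rw [norm_mul, norm_norm, Real.norm_of_nonneg (by positivity)]
    exact mul_le_of_le_one_right (norm_nonneg _)
      (Real.rpow_le_one_of_one_le_of_nonpos h1 (neg_nonpos.2 hs))
  simpa only [piecewise_same] using
    near_zero.piecewise Metric.isOpen_ball.measurableSet away_from_zero

lemma one_add_rpow_le_two_rpow_mul {r : ℝ} (hr : 0 ≤ r) (hs : 0 ≤ s) :
    (1 + r) ^ s ≤ 2 ^ s * (1 + r ^ s) := by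
  have hmax : (1 + r) ^ s ≤ (2 * max 1 r) ^ s := by
    gcongr
    linarith [le_max_left 1 r, le_max_right 1 r]
  rw [Real.mul_rpow zero_le_two (by positivity)] at hmax
  refine hmax.trans ?_
  gcongr
  rcases max_cases 1 r with ⟨h, -⟩ | ⟨h, -⟩ <;> rw [h]
  · rw [Real.one_rpow]
    exact le_add_of_nonneg_right (by positivity)
  · exact le_add_of_nonneg_left zero_le_one

lemma memLp_one_div_one_add_norm_rpow (hp : p ≠ 0) (hp' : p ≠ ⊤) (hs : 0 ≤ s)
    (hsp : Module.finrank ℝ E < s * p.toReal) :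
    MemLp (fun x : E => 1 / (1 + ‖x‖ ^ s)) p μ := by
  have hbracket : MemLp (fun x : E => (1 + ‖x‖) ^ (-s)) p μ := by
    refine (integrable_norm_rpow_iff (by fun_prop : Measurable _).aestronglyMeasurable hp hp').1 ?_
    refine (integrable_one_add_norm hsp).congr (ae_of_all _ fun x => ?_)
    dsimp only
    rw [Real.norm_of_nonneg (by positivity), ← Real.rpow_mul (by positivity), neg_mul]
  refine hbracket.of_le_mul (c := 2 ^ s) (by fun_prop : Measurable _).aestronglyMeasurable
    (ae_of_all _ fun x => ?_)
  rw [Real.norm_of_nonneg (by positivity), Real.norm_of_nonneg (by positivity),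
    Real.rpow_neg (by positivity), ← div_eq_mul_inv, div_le_div_iff₀ (by positivity)
    (by positivity), one_mul]
  exact one_add_rpow_le_two_rpow_mul (norm_nonneg x) hs

end RieszWeight

section Decay

variable {d : ℕ} [NeZero d] {ρ : ℝ} {u₀ : EuclideanSpace ℝ (Fin d) → ℂ}

lemma IsPC.eLpNorm_mildSolution_eq {k ℓ : ℝ → ℝ} {t : ℝ} (h : IsPC k ℓ) (hρ : 0 < ρ) (ht : 0 < t)
    (hu₁ : Integrable u₀) (hu₂ : MemLp u₀ 2 volume) :
    eLpNorm (mildSolution d ρ k u₀ t) 2 volume =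
      eLpNorm (𝓕 (mildSolution d ρ k u₀ t)) 2 volume :=
  have := h.isMemoryKernel.isFiniteMeasure_propagationMeasure ht.le
  (eLpNorm_fourier (integrable_mildSolution hρ hu₁) (h.memLp_mildSolution hρ ht hu₁ hu₂)).symm

lemma eLpNorm_const_mul_eq_ofReal {α : Type*} [MeasurableSpace α] {μ : Measure α} {p : ℝ≥0∞}
    {g : α → ℝ} (hg : MemLp g p μ) {c : ℝ} (hc : 0 ≤ c) :
    eLpNorm (fun x => c * g x) p μ = ENNReal.ofReal (c * (eLpNorm g p μ).toReal) := by
  rw [ENNReal.ofReal_mul hc, ENNReal.ofReal_toReal hg.2.ne, ← Real.enorm_of_nonneg hc]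
  exact eLpNorm_const_smul c g p μ

lemma IsPC.norm_fourier_mildSolution_le_inv_mul {k ℓ : ℝ → ℝ} {t : ℝ} (h : IsPC k ℓ) (hρ : 0 < ρ)
    (ht : 0 < t) (hu₁ : Integrable u₀) {ζ : EuclideanSpace ℝ (Fin d)} (hζ : ζ ≠ 0) :
    ‖𝓕 (mildSolution d ρ k u₀ t) ζ‖ ≤
      (timeConv (fun _ => 1) ℓ t)⁻¹ * ((2 * Real.pi) ^ ρ)⁻¹ * (‖𝓕 u₀ ζ‖ * ‖ζ‖ ^ (-ρ)) := by
  have hL := h.timeConv_one_pos ht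
  set L := timeConv (fun _ => 1) ℓ t
  have hζ' : 0 < ‖ζ‖ := norm_pos_iff.2 hζ
  calc ‖𝓕 (mildSolution d ρ k u₀ t) ζ‖
      ≤ ‖𝓕 u₀ ζ‖ * (1 / (1 + (2 * Real.pi * ‖ζ‖) ^ ρ * L)) :=
        h.norm_fourier_mildSolution_le hρ ht hu₁ hζ
    _ ≤ ‖𝓕 u₀ ζ‖ * (1 / ((2 * Real.pi * ‖ζ‖) ^ ρ * L)) := by
        gcongr
        exact le_add_of_nonneg_left zero_le_one
    _ = L⁻¹ * ((2 * Real.pi) ^ ρ)⁻¹ * (‖𝓕 u₀ ζ‖ * ‖ζ‖ ^ (-ρ)) := by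
        rw [Real.mul_rpow (by positivity) hζ'.le, one_div, mul_inv, mul_inv,
          ← Real.rpow_neg hζ'.le]
        ring

theorem exists_eLpNorm_mildSolution_le_of_two_mul_lt (hρ : 0 < ρ) (hdρ : 2 * ρ < d)
    (hu₁ : Integrable u₀) (hu₂ : MemLp u₀ 2 volume) :
    ∃ C : ℝ, 0 < C ∧ ∀ k ℓ : ℝ → ℝ, IsPC k ℓ → ∀ t : ℝ, 0 < t →
      eLpNorm (mildSolution d ρ k u₀ t) 2 volume ≤
        ENNReal.ofReal (C * timeConv (fun _ => 1) ℓ t ^ (-1 : ℝ)) := by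
  let g : EuclideanSpace ℝ (Fin d) → ℝ := fun ζ => ‖𝓕 u₀ ζ‖ * ‖ζ‖ ^ (-ρ)
  have hg : MemLp g 2 volume :=
    memLp_norm_mul_norm_rpow_neg two_ne_zero ENNReal.ofNat_ne_top hρ.le
      (by simpa [mul_comm] using hdρ) (memLp_fourier hu₁ hu₂) (norm_fourier_le_integral_norm u₀)
  refine ⟨((2 * Real.pi) ^ ρ)⁻¹ * (eLpNorm g 2 volume).toReal + 1, by positivity,
    fun k ℓ h t ht => ?_⟩
  have hL := h.timeConv_one_pos ht
  set L := timeConv (fun _ => 1) ℓ t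
  have hbound : ∀ᵐ ζ : EuclideanSpace ℝ (Fin d), ‖𝓕 (mildSolution d ρ k u₀ t) ζ‖ ≤
      L⁻¹ * ((2 * Real.pi) ^ ρ)⁻¹ * g ζ := by
    filter_upwards [Measure.ae_ne volume 0] with ζ hζ
    exact h.norm_fourier_mildSolution_le_inv_mul hρ ht hu₁ hζ
  rw [h.eLpNorm_mildSolution_eq hρ ht hu₁ hu₂]
  refine (eLpNorm_mono_ae_real hbound).trans ?_
  rw [eLpNorm_const_mul_eq_ofReal hg (by positivity), Real.rpow_neg_one, mul_assoc, mul_comm]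
  gcongr
  exact le_add_of_nonneg_right zero_le_one

lemma IsPC.norm_fourier_mildSolution_le_mul_comp_smul {k ℓ : ℝ → ℝ} {t : ℝ} (h : IsPC k ℓ)
    (hρ : 0 < ρ) (ht : 0 < t) (hu₁ : Integrable u₀) {ζ : EuclideanSpace ℝ (Fin d)} (hζ : ζ ≠ 0) :
    ‖𝓕 (mildSolution d ρ k u₀ t) ζ‖ ≤ (∫ x, ‖u₀ x‖) *
      (1 / (1 + ‖(2 * Real.pi * timeConv (fun _ => 1) ℓ t ^ ρ⁻¹) • ζ‖ ^ ρ)) := by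
  have hL := h.timeConv_one_pos ht
  set L := timeConv (fun _ => 1) ℓ t
  have hscale : ‖(2 * Real.pi * L ^ ρ⁻¹) • ζ‖ ^ ρ = (2 * Real.pi * ‖ζ‖) ^ ρ * L := by
    rw [norm_smul, Real.norm_of_nonneg (by positivity), mul_right_comm,
      Real.mul_rpow (by positivity) (by positivity), Real.rpow_inv_rpow hL.le hρ.ne']
  rw [hscale]
  refine (h.norm_fourier_mildSolution_le hρ ht hu₁ hζ).trans ?_
  gcongr
  exact norm_fourier_le_integral_norm u₀ ζ

theorem exists_eLpNorm_mildSolution_le_of_lt_two_mul (hρ : 0 < ρ) (hdρ : d < 2 * ρ)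
    (hu₁ : Integrable u₀) (hu₂ : MemLp u₀ 2 volume) :
    ∃ C : ℝ, 0 < C ∧ ∀ k ℓ : ℝ → ℝ, IsPC k ℓ → ∀ t : ℝ, 0 < t →
      eLpNorm (mildSolution d ρ k u₀ t) 2 volume ≤
        ENNReal.ofReal (C * timeConv (fun _ => 1) ℓ t ^ (-((d : ℝ) / (2 * ρ)))) := by
  let g : EuclideanSpace ℝ (Fin d) → ℝ := fun ζ => 1 / (1 + ‖ζ‖ ^ ρ)
  have hg : MemLp g 2 volume :=
    memLp_one_div_one_add_norm_rpow two_ne_zero ENNReal.ofNat_ne_top hρ.le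
      (by simpa [mul_comm] using hdρ)
  set M : ℝ := ∫ x, ‖u₀ x‖
  have hM : 0 ≤ M := integral_nonneg fun _ => norm_nonneg _
  set N : ℝ := (eLpNorm g 2 volume).toReal
  refine ⟨(2 * Real.pi) ^ (-((d : ℝ) / 2)) * (M * N) + 1, by positivity, fun k ℓ h t ht => ?_⟩
  have hL := h.timeConv_one_pos ht
  set L := timeConv (fun _ => 1) ℓ t
  set c : ℝ := 2 * Real.pi * L ^ ρ⁻¹
  have hbound : ∀ᵐ ζ : EuclideanSpace ℝ (Fin d),
      ‖𝓕 (mildSolution d ρ k u₀ t) ζ‖ ≤ M * g (c • ζ) := by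
    filter_upwards [Measure.ae_ne volume 0] with ζ hζ
    exact h.norm_fourier_mildSolution_le_mul_comp_smul hρ ht hu₁ hζ
  have hc : c ^ (-((d : ℝ) / 2)) =
      (2 * Real.pi) ^ (-((d : ℝ) / 2)) * L ^ (-((d : ℝ) / (2 * ρ))) := by
    rw [Real.mul_rpow (by positivity) (by positivity), ← Real.rpow_mul hL.le]
    congr 2
    field_simp
  calc eLpNorm (mildSolution d ρ k u₀ t) 2 volume
      = eLpNorm (𝓕 (mildSolution d ρ k u₀ t)) 2 volume :=
        h.eLpNorm_mildSolution_eq hρ ht hu₁ hu₂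
    _ ≤ eLpNorm (fun ζ => (fun η => M * g η) (c • ζ)) 2 volume := eLpNorm_mono_ae_real hbound
    _ = ENNReal.ofReal (c ^ (-((d : ℝ) / 2))) * ENNReal.ofReal (M * N) := by
        rw [eLpNorm_comp_smul volume (fun η => M * g η) (by positivity) ENNReal.ofNat_ne_top,
          eLpNorm_const_mul_eq_ofReal hg hM, finrank_euclideanSpace_fin, ENNReal.toReal_ofNat]
    _ = ENNReal.ofReal ((2 * Real.pi) ^ (-((d : ℝ) / 2)) * (M * N) *
          L ^ (-((d : ℝ) / (2 * ρ)))) := by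
        rw [← ENNReal.ofReal_mul (by positivity), hc]
        congr 1
        ring
    _ ≤ _ := by
        gcongr
        exact le_add_of_nonneg_right zero_le_one

end Decay

end NonlocalDiffusion

end

open MeasureTheory Set NonlocalDiffusion in
theorem mainTheorem5_general (d : ℕ) (hd : 0 < d) (ρ : ℝ) (hρ : 0 < ρ) (hdρ : (d : ℝ) ≠ 2 * ρ)
    (u₀ : EuclideanSpace ℝ (Fin d) → ℂ) (hu₁ : Integrable u₀ volume) (hu₂ : MemLp u₀ 2 volume) :
    ∃ C : ℝ, 0 < C ∧ ∀ k ℓ : ℝ → ℝ, IsPC k ℓ → ∀ t : ℝ, 0 < t →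
      (∀ᵐ x : EuclideanSpace ℝ (Fin d),
        IntegrableOn (fun τ => eta d ρ τ x) (Ioi 0) (propagationMeasure k t)) ∧
      (∀ᵐ x : EuclideanSpace ℝ (Fin d),
        Integrable (fun y => fundamentalSolution d ρ k t (x - y) * u₀ y) volume) ∧
      MemLp (mildSolution d ρ k u₀ t) 2 volume ∧
      eLpNorm (mildSolution d ρ k u₀ t) 2 volume ≤
        ENNReal.ofReal (C * timeConv (fun _ => 1) ℓ t ^ (-(min 1 ((d : ℝ) / (2 * ρ))))) := by
  have : NeZero d := ⟨hd.ne'⟩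
  obtain ⟨C, hC, hdecay⟩ : ∃ C : ℝ, 0 < C ∧ ∀ k ℓ : ℝ → ℝ, IsPC k ℓ → ∀ t : ℝ, 0 < t →
      eLpNorm (mildSolution d ρ k u₀ t) 2 volume ≤
        ENNReal.ofReal (C * timeConv (fun _ => 1) ℓ t ^ (-(min 1 ((d : ℝ) / (2 * ρ))))) := by
    rcases lt_or_gt_of_ne hdρ with hlow | hhigh
    · rw [min_eq_right (div_le_one_of_le₀ hlow.le (by positivity))]
      exact exists_eLpNorm_mildSolution_le_of_lt_two_mul hρ hlow hu₁ hu₂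
    · rw [min_eq_left ((one_le_div (by positivity)).2 hhigh.le)]
      exact exists_eLpNorm_mildSolution_le_of_two_mul_lt hρ hhigh hu₁ hu₂
  refine ⟨C, hC, fun k ℓ h t ht => ?_⟩
  have := h.isMemoryKernel.isFiniteMeasure_propagationMeasure ht.le
  exact ⟨(integrable_eta_uncurry hρ (propagationMeasure k t)).prod_right_ae,
    ae_integrable_fundamentalSolution_mul hρ hu₁, h.memLp_mildSolution hρ ht hu₁ hu₂,
    hdecay k ℓ h t ht⟩

open MeasureTheory Set NonlocalDiffusion in
theorem mainTheorem5 (d : ℕ) (hd : 0 < d) (ρ : ℝ) (hρ : 0 < ρ) (hdρ : (d : ℝ) ≠ 2 * ρ)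
    (k ℓ : ℝ → ℝ) (hkl : IsPC k ℓ)
    (u₀ : EuclideanSpace ℝ (Fin d) → ℂ) (hu₁ : Integrable u₀ volume) (hu₂ : MemLp u₀ 2 volume) :
    -- the integrals that define `Z(t, ·)` and `u(t, ·)` converge almost everywhere
    (∀ t : ℝ, 0 < t →
      (∀ᵐ x : EuclideanSpace ℝ (Fin d),
        IntegrableOn (fun τ => eta d ρ τ x) (Ioi 0) (propagationMeasure k t)) ∧
      (∀ᵐ x : EuclideanSpace ℝ (Fin d),
        Integrable (fun y => fundamentalSolution d ρ k t (x - y) * u₀ y) volume) ∧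
      MemLp (mildSolution d ρ k u₀ t) 2 volume) ∧
    -- the decay estimate
    ∃ C : ℝ, 0 < C ∧ ∀ t : ℝ, 1 < t →
      eLpNorm (mildSolution d ρ k u₀ t) 2 volume ≤
        ENNReal.ofReal (C * timeConv (fun _ => 1) ℓ t ^ (-(min 1 ((d : ℝ) / (2 * ρ))))) := by
  obtain ⟨C, hC, h⟩ := mainTheorem5_general d hd ρ hρ hdρ u₀ hu₁ hu₂
  exact ⟨fun t ht => ⟨(h k ℓ hkl t ht).1, (h k ℓ hkl t ht).2.1, (h k ℓ hkl t ht).2.2.1⟩,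
    C, hC, fun t ht => (h k ℓ hkl t (one_pos.trans ht)).2.2.2⟩
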